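/- Let $V$ be a closed isometric operator in a separable complex Hilbert space $H$ (its domain $D(V)$ is a linear subspace that need not be dense, $\|Vx\|=\|x\|$ for $x\in D(V)$, and the graph of $V$ is closed), and let $E$ denote the identity operator. Write $\mathbb D=\{|z|<1\}$ and $\mathbb T_e=\{z\in\mathbb C:|z|\ne1\}$. **Generalized resolvents.** A generalized resolvent of an isometric operator $V$ is a function $\mathbf R(V):\zeta\mapsto \mathbf R_\zeta(V)=P_H(E_{\widetilde H}-\zeta U)^{-1}|_H$, $\zeta\in\mathbb T_e$, where $U\supseteq V$ is a unitary operator in a separable Hilbert space $\widetilde H\supseteq H$ and $P_H$ is the orthogonal projection of $\widetilde H$ onto $H$. **Notation.** Put $M_\zeta=(E-\zeta V)D(V)$ for $\zeta\in\mathbb C$, $M_\infty=R(V)$ (the range of $V$), and $N_\zeta=H\ominus M_\zeta$. For subspaces $H_1,H_2$ of $H$, let $\mathcal S(H_1;H_2)$ be the set of all analytic operator-valued functions on $\mathbb D$ whose values are linear contractions from $H_1$ to $H_2$. Fix $z_0\in\mathbb D$, with the convention $1/\overline{z_0}=\infty$ if $z_0=0$, and put $$V_{z_0}=(V-\overline{z_0}E)(E-z_0V)^{-1},$$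 an isometric operator with domain $M_{z_0}$ and range $M_{1/\overline{z_0}}$. For a bounded linear operator $C:N_{z_0}\to N_{1/\overline{z_0}}$ such that the inverse below exists (in particular for every contraction $C$) put $$V^+_{z_0;C}=V_{z_0}\oplus C,\qquad V_{C}=V_{C;z_0}=(V^+_{z_0;C}+\overline{z_0}E)(E+z_0V^+_{z_0;C})^{-1}.$$ Then the following hold. 1. (Inin's formula.) The formula $$\mathbf R_\zeta(V)=\left[E-\zeta V_{C(\zeta);z_0}\right]^{-1},\qquad \zeta\in\mathbb D,$$ establishes a one-to-one correspondence between all generalized resolvents $\mathbf R(V)$ of $V$ and all functions $C\in\mathcal S(N_{z_0};N_{1/\overline{z_0}})$: for each generalized resolvent there is exactly one such $C$, and for each such $C$ exactly one generalized resolvent, for which the formula holds (in particular, the inverse exists and is a bounded operator defined on all of $H$). 2. The relation $$\mathbf R_{u}(V)=-\frac{z_0}{u-z_0}E+\frac{u(1-|z_0|^2)}{(u-z_0)(1-\overline{z_0}u)}\,\mathbf R_{\frac{u-z_0}{1-\overline{z_0}u}}(V_{z_0}),\qquad u\in\mathbb T_e\setminus\{0,z_0,1/\overline{z_0}\},$$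 establishes a one-to-one correspondence between all generalized resolvents of $V$ and all generalized resolvents of $V_{z_0}$. -/

import Mathlib

open scoped ComplexConjugate InnerProduct OnePoint

universe u

namespace IsometricResolvent

open Complex.UnitDisc

noncomputable section

variable {H : Type u} [NormedAddCommGroup H] [InnerProductSpace ℂ H]

/-- The identity operator `E`, with domain the whole space. -/
def E (H : Type u) [NormedAddCommGroup H] [InnerProductSpace ℂ H] : H →ₗ.[ℂ] H :=
  (LinearMap.id : H →ₗ[ℂ] H).toPMap ⊤

/-- The product `S T` of two partially defined operators, with its natural domain
`{x ∈ D(T) : T x ∈ D(S)}`. -/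
def product (S T : H →ₗ.[ℂ] H) : H →ₗ.[ℂ] H :=
  S.comp (T.domRestrict ((S.domain.comap T.toFun).map T.domain.subtype)) (by
    rintro ⟨x, hx⟩
    obtain ⟨y, hy, hyx⟩ := hx.1
    have h : T.domRestrict ((S.domain.comap T.toFun).map T.domain.subtype) ⟨x, hx⟩ = T y :=
      LinearPMap.domRestrict_apply hyx.symm
    rw [h]
    exact hy)

/-- The linear-fractional transform `T_z = (T - z̄ E) (E - z T)⁻¹`. -/
def moebius (z : ℂ) (T : H →ₗ.[ℂ] H) : H →ₗ.[ℂ] H :=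
  product (T - conj z • E H) (E H - z • T).inverse

/-- `V` is an isometric operator (on its domain, which need not be dense). -/
def IsIsometric (V : H →ₗ.[ℂ] H) : Prop :=
  ∀ x : V.domain, ‖V x‖ = ‖(x : H)‖

/-- `M_ζ(V) = (E - ζ V) D(V)` for `ζ ∈ ℂ`, and `M_∞(V) = R(V)`. -/
def M (V : H →ₗ.[ℂ] H) (ζ : OnePoint ℂ) : Submodule ℂ H :=
  ζ.elim (LinearMap.range V.toFun) (fun w => LinearMap.range (E H - w • V).toFun)

/-- The defect subspace `N_ζ(V) = H ⊖ M_ζ(V)`. -/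
def N (V : H →ₗ.[ℂ] H) (ζ : OnePoint ℂ) : Submodule ℂ H :=
  (M V ζ)ᗮ

/-- The point `1 / z̄` of the extended plane (`∞` if `z = 0`). -/
def reflect (z : ℂ) : OnePoint ℂ :=
  if z = 0 then ∞ else (((conj z)⁻¹ : ℂ) : OnePoint ℂ)

theorem moebius_domain_le (z : ℂ) (V : H →ₗ.[ℂ] H) :
    (moebius z V).domain ≤ M V (z : OnePoint ℂ) := by
  intro x hx
  have h : x ∈ (E H - z • V).inverse.domain := hx.2
  rw [LinearPMap.inverse_domain] at h
  exact h

/-- The operator `V⁺_{z;C} = V_z ⊕ C`, where `C` is a bounded operator from `N_z` to `N_{1/z̄}`. -/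
def plusExtension (V : H →ₗ.[ℂ] H) (z : ℂ) (C : N V z →L[ℂ] N V (reflect z)) : H →ₗ.[ℂ] H :=
  (moebius z V).sup ⟨N V z, (N V (reflect z)).subtype ∘ₗ C.toLinearMap⟩
    (LinearPMap.sup_h_of_disjoint _ _
      ((Submodule.orthogonal_disjoint (M V z)).mono_left (moebius_domain_le z V)))

/-- The orthogonal extension `V_{C;z} = (V⁺_{z;C} + z̄ E) (E + z V⁺_{z;C})⁻¹` of `V`. -/
def orthogonalExtension (V : H →ₗ.[ℂ] H) (z : ℂ) (C : N V z →L[ℂ] N V (reflect z)) :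
    H →ₗ.[ℂ] H :=
  product (plusExtension V z C + conj z • E H) (E H + z • plusExtension V z C).inverse

/-- The class `S(H₁; H₂)` of analytic functions in the unit disc whose values are contractions
from `H₁` to `H₂`. -/
def SchurClass (H₁ H₂ : Submodule ℂ H) : Set (Complex.UnitDisc → H₁ →L[ℂ] H₂) :=
  {F | (∃ G : ℂ → H₁ →L[ℂ] H₂, AnalyticOnNhd ℂ G (Metric.ball 0 1) ∧ ∀ ζ : 𝔻, G ζ = F ζ) ∧
    ∀ ζ : 𝔻, ‖F ζ‖ ≤ 1}

/-- The set `{ζ : |ζ| ≠ 1}`, on which generalized resolvents are defined. -/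
abbrev OffCircle : Type := {ζ : ℂ // ‖ζ‖ ≠ 1}

/-- The inclusion of the open unit disc in `{ζ : |ζ| ≠ 1}`. -/
def discPoint (ζ : 𝔻) : OffCircle := ⟨ζ, ζ.norm_ne_one⟩

/-- A unitary operator `U` in a separable Hilbert space `K` that contains `H` (through the
isometric embedding `J`) and such that `U` extends `V`. -/
structure UnitaryExtension (V : H →ₗ.[ℂ] H) where
  K : Type u
  [normedAddCommGroup : NormedAddCommGroup K]
  [innerProductSpace : InnerProductSpace ℂ K]
  [completeSpace : CompleteSpace K]
  [separableSpace : TopologicalSpace.SeparableSpace K]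
  J : H →ₗᵢ[ℂ] K
  U : K ≃ₗᵢ[ℂ] K
  extends_V : ∀ x : V.domain, U (J x) = J (V x)

attribute [instance] UnitaryExtension.normedAddCommGroup UnitaryExtension.innerProductSpace
  UnitaryExtension.completeSpace UnitaryExtension.separableSpace

/-- The function `ζ ↦ P_H (E - ζ U)⁻¹ |_H`, `|ζ| ≠ 1`. The adjoint of the embedding `J` is the
orthogonal projection of `K` onto `H`. -/
def UnitaryExtension.resolvent [CompleteSpace H] {V : H →ₗ.[ℂ] H} (W : UnitaryExtension V)
    (ζ : OffCircle) : H →L[ℂ] H :=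
  ContinuousLinearMap.adjoint W.J.toContinuousLinearMap ∘L
    Ring.inverse (1 - (ζ : ℂ) • (W.U : W.K →L[ℂ] W.K)) ∘L W.J.toContinuousLinearMap

/-- The set of all generalized resolvents of `V`. -/
def GeneralizedResolvents [CompleteSpace H] (V : H →ₗ.[ℂ] H) : Set (OffCircle → H →L[ℂ] H) :=
  Set.range fun W : UnitaryExtension V => W.resolvent

/-- `R = T⁻¹`: the operator `T` is a bijection of its domain onto the whole space, and its inverse
is the bounded operator `R`. -/
def IsInverse (R : H →L[ℂ] H) (T : H →ₗ.[ℂ] H) : Prop :=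
  (∀ h : H, ∃ hR : R h ∈ T.domain, T ⟨R h, hR⟩ = h) ∧ ∀ f : T.domain, R (T f) = f

/-- Inin's formula `R_ζ = (E - ζ V_{C(ζ);z₀})⁻¹` for all `ζ` in the unit disc. -/
def IninFormula (V : H →ₗ.[ℂ] H) (z₀ : 𝔻)
    (R : OffCircle → H →L[ℂ] H) (C : 𝔻 → N V (z₀ : ℂ) →L[ℂ] N V (reflect z₀)) : Prop :=
  ∀ ζ : 𝔻, IsInverse (R (discPoint ζ)) (E H - (ζ : ℂ) • orthogonalExtension V z₀ (C ζ))

/-- The relation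
`R_u = -z₀ / (u - z₀) E + u (1 - |z₀|²) / ((u - z₀) (1 - z̄₀ u)) Q_t`, `t = (u - z₀) / (1 - z̄₀ u)`,
for all `u` with `|u| ≠ 1` other than `0`, `z₀`, `1 / z̄₀`. -/
def MoebiusRelation (z₀ : 𝔻) (R Q : OffCircle → H →L[ℂ] H) : Prop :=
  ∀ u t : OffCircle, (u : ℂ) ≠ 0 → (u : ℂ) ≠ z₀ → 1 - conj (z₀ : ℂ) * u ≠ 0 →
    (t : ℂ) = (u - z₀) / (1 - conj (z₀ : ℂ) * u) →
    R u = (-(z₀ : ℂ) / (u - z₀)) • (1 : H →L[ℂ] H)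
      + ((u : ℂ) * (1 - (‖(z₀ : ℂ)‖ : ℂ) ^ 2)
          / (((u : ℂ) - z₀) * (1 - conj (z₀ : ℂ) * u))) • Q t

end

end IsometricResolvent

/-! Both parts rest on one description: on the disc, the generalized resolvents of V are exactly the
functions (E - ζ S(ζ))⁻¹ with S analytic, contractive and with S(ζ) extending V.

Given a unitary extension U, let P be the projection onto H, Q = 1 - P, and S(z) = P U (1 - z Q U)⁻¹
restricted to H. If y = (1 - z Q U)⁻¹ h, then y = h + z Q U y. Comparing ‖y‖ = ‖U y‖ with the
orthogonal decompositions of y and U y gives ‖S(z) h‖ ≤ ‖h‖ (`exists_contractive_extension`).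

Conversely, F(z) = (1 - z S(z))⁻¹ satisfies F(0) = 1 and 2 Re F ≥ 1. Hence its Taylor coefficients,
continued to negative indices by adjoints, form a positive definite sequence
(`toeplitzSymbol_posDef`), and Naimark's theorem produces a unitary U whose powers compress to them.
Since F'(0) = S(0) extends V, equality of norms forces U to extend V (`exists_unitaryExtension`).

It remains to parametrize the contractive extensions of V. The transform (T - z̄)(1 - z T)⁻¹ is a
bijection of the contractions on H, inverted by the parameter -z, and carries extensions of V to
extensions of V_z. As V is closed, M_z is closed; a contraction that is isometric on M_z preserves
inner products with it, so it splits as V_z ⊕ C (`exists_blockOperator_eq`). Thus S and C determine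
each other analytically. The resolvent determines S(ζ) for ζ ≠ 0, and continuity handles ζ = 0. The
values outside the disc follow from R_{1/z̄} = 1 - R_z*.

For the second part the same transform is applied to U itself: it yields a unitary extension of V_z
in the same space, and the relation is the compression of an identity between the resolvents of the
two unitary operators (`inverse_one_sub_moebius`). -/

namespace IsometricResolvent

open Complex Filter Topology

noncomputable section

/-! ### Naimark dilation on the integers -/

section Dilation

/-- Two families with dense span and the same Gram matrix differ by a unitary operator. -/
theorem exists_linearIsometryEquiv_of_inner_eq {ι K : Type*} [NormedAddCommGroup K]
    [InnerProductSpace ℂ K] [CompleteSpace K] (k k' : ι → K)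
    (hk : DenseRange (Finsupp.linearCombination ℂ k))
    (hk' : DenseRange (Finsupp.linearCombination ℂ k'))
    (h : ∀ i j, inner ℂ (k' i) (k' j) = inner ℂ (k i) (k j)) :
    ∃ U : K ≃ₗᵢ[ℂ] K, ∀ i, U (k i) = k' i := by
  have hnorm : ∀ x : ι →₀ ℂ, ‖Finsupp.linearCombination ℂ k' x‖
      = ‖Finsupp.linearCombination ℂ k x‖ := by
    intro x
    rw [@norm_eq_sqrt_re_inner ℂ, @norm_eq_sqrt_re_inner ℂ]
    simp only [Finsupp.linearCombination_apply, Finsupp.sum_inner, Finsupp.inner_sum,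
      inner_smul_left, inner_smul_right, h]
  refine ⟨(LinearEquiv.refl ℂ (ι →₀ ℂ)).extendOfIsometry (Finsupp.linearCombination ℂ k)
    (Finsupp.linearCombination ℂ k') hk hk' hnorm, fun i => ?_⟩
  have := (LinearEquiv.refl ℂ (ι →₀ ℂ)).extendOfIsometry_eq (Finsupp.linearCombination ℂ k)
    (Finsupp.linearCombination ℂ k') hk hk' hnorm (Finsupp.single i 1)
  simpa using this

variable {H : Type u} [NormedAddCommGroup H] [InnerProductSpace ℂ H] [CompleteSpace H]

open RKHS in
/-- Naimark's dilation theorem for positive definite operator-valued sequences on `ℤ`. -/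
theorem exists_unitary_of_posDef [TopologicalSpace.SeparableSpace H] (c : ℤ → H →L[ℂ] H)
    (h0 : c 0 = 1) (hstar : ∀ n, c (-n) = ContinuousLinearMap.adjoint (c n))
    (hpos : ∀ v : ℤ →₀ H,
      0 ≤ (v.sum fun m x => v.sum fun n y => inner ℂ (c (m - n) x) y).re) :
    ∃ (K : Type u) (_ : NormedAddCommGroup K) (_ : InnerProductSpace ℂ K) (_ : CompleteSpace K)
      (_ : TopologicalSpace.SeparableSpace K) (J : H →ₗᵢ[ℂ] K) (U : K ≃ₗᵢ[ℂ] K),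
      ∀ (n : ℕ) (x y : H), inner ℂ (((U : K →L[ℂ] K) ^ n) (J x)) (J y) = inner ℂ (c n x) y := by
  let M : Matrix ℤ ℤ (H →L[ℂ] H) := .of fun m n => c (n - m)
  have hM : M.PosSemidef := by
    have h := (posSemidef_tfae (K := M)).out 0 2
    refine h.mpr ⟨?_, fun v => ?_⟩
    · ext1 m n
      simp only [Matrix.conjTranspose_apply, M, Matrix.of_apply, ContinuousLinearMap.star_eq_adjoint,
        ← hstar, neg_sub]
    · simpa [M] using hpos v
  have : Fact M.PosSemidef := ⟨hM⟩
  let K := OfKernel M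
  let k : ℤ × H → K := fun p => kerFun K p.1 p.2
  have hinner : ∀ m n x y, inner ℂ (kerFun K m x) (kerFun K n y) = inner ℂ (c (m - n) x) y := by
    intro m n x y
    rw [← kernel_inner, OfKernel.kernel_ofKernel]
    simp [M]
  have hspan : {kerFun K m x | (m) (x)} = Set.range k := by
    ext a; simp [k]
  have hk : DenseRange (Finsupp.linearCombination ℂ k) := by
    have h := kerFun_dense (𝕜 := ℂ) (H := K)
    rw [hspan] at h
    rw [DenseRange, ← LinearMap.coe_range, Finsupp.range_linearCombination]
    exact Submodule.dense_iff_topologicalClosure_eq_top.mpr h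
  -- The Gram matrix depends only on m - n, so shifting the index preserves it; the resulting
  -- unitary is the bilateral shift.
  let k' : ℤ × H → K := fun p => kerFun K (p.1 + 1) p.2
  have hk' : DenseRange (Finsupp.linearCombination ℂ k') := by
    have h : Set.range k' = Set.range k := by
      ext a
      constructor
      · rintro ⟨p, rfl⟩; exact ⟨(p.1 + 1, p.2), rfl⟩
      · rintro ⟨p, rfl⟩; exact ⟨(p.1 - 1, p.2), by simp [k, k']⟩
    rw [DenseRange, ← LinearMap.coe_range, Finsupp.range_linearCombination, h,
      ← Finsupp.range_linearCombination]
    exact hk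
  obtain ⟨U, hU⟩ := exists_linearIsometryEquiv_of_inner_eq k k' hk hk' (by
    rintro ⟨m, x⟩ ⟨n, y⟩
    simp only [k, k', hinner]
    congr 3
    ring)
  -- K is the closed span of countably many continuous images of the separable space H.
  have hsep : TopologicalSpace.SeparableSpace K := by
    rw [← TopologicalSpace.isSeparable_univ_iff]
    have h := kerFun_dense (𝕜 := ℂ) (H := K)
    rw [hspan] at h
    have hc : Continuous k := continuous_prod_of_discrete_left.mpr fun m =>
      (kerFun K m).continuous
    have h1 := ((TopologicalSpace.isSeparable_range hc).span (R := ℂ)).closure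
    rwa [← Submodule.topologicalClosure_coe, h] at h1
  let J : H →ₗᵢ[ℂ] K := (kerFun K (0 : ℤ)).toLinearMap.isometryOfInner (fun x y => by
    simp only [ContinuousLinearMap.coe_coe, hinner]
    simp [h0])
  have hJ : ∀ x, J x = kerFun K (0 : ℤ) x := fun _ => rfl
  have hpow : ∀ (n : ℕ) x, ((U : K →L[ℂ] K) ^ n) (J x) = kerFun K (n : ℤ) x := by
    intro n x
    induction n with
    | zero => simp [hJ]
    | succ n ih =>
      rw [pow_succ', mul_apply_eq_comp, ih]
      have := hU (n, x)
      simpa [k, k'] using this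
  refine ⟨K, inferInstance, inferInstance, inferInstance, hsep, J, U, fun n x y => ?_⟩
  rw [hpow, hJ, hinner, sub_zero]

end Dilation

/-! ### Positive definiteness of the Taylor coefficients -/

section Toeplitz

theorem integral_exp_int_mul_I (k : ℤ) :
    ∫ θ in (0 : ℝ)..2 * Real.pi, exp (k * I * θ) = if k = 0 then 2 * (Real.pi : ℂ) else 0 := by
  split_ifs with hk
  · simp [hk]
  · have hk' : (k : ℂ) * I ≠ 0 := mul_ne_zero (by exact_mod_cast hk) I_ne_zero
    have : exp (k * I * ((2 * Real.pi : ℝ) : ℂ)) = 1 := by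
      rw [exp_eq_one_iff]
      exact ⟨k, by push_cast; ring⟩
    rw [integral_exp_mul_complex hk', this]
    simp

/-- The Fourier coefficients of an absolutely convergent trigonometric series. -/
theorem integral_exp_mul_of_hasSum {b : ℤ → ℂ} (hb : Summable b) {g : ℝ → ℂ}
    (hg : ∀ θ : ℝ, HasSum (fun k : ℤ => exp (-(k * I * θ)) * b k) (g θ)) (j : ℤ) :
    ∫ θ in (0 : ℝ)..2 * Real.pi, exp (j * I * θ) * g θ = 2 * Real.pi * b j := by
  have hnorm : ∀ (k : ℤ) (θ : ℝ), ‖exp (k * I * θ)‖ = 1 := fun k θ => by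
    have : (k : ℂ) * I * θ = ((k * θ : ℝ) : ℂ) * I := by push_cast; ring
    rw [this, norm_exp_ofReal_mul_I]
  have hterm : ∀ (k : ℤ) (θ : ℝ), exp (j * I * θ) * (exp (-(k * I * θ)) * b k)
      = exp ((j - k : ℤ) * I * θ) * b k := fun k θ => by
    rw [← mul_assoc, ← exp_add]
    congr 2
    push_cast
    ring
  have h := intervalIntegral.hasSum_integral_of_dominated_convergence (a := 0)
    (b := 2 * Real.pi) (μ := MeasureTheory.volume)
    (F := fun (k : ℤ) (θ : ℝ) => exp (j * I * θ) * (exp (-(k * I * θ)) * b k))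
    (f := fun θ => exp (j * I * θ) * g θ) (fun k _ => ‖b k‖)
    (fun k => Continuous.aestronglyMeasurable (by fun_prop))
    (fun k => by
      refine .of_forall fun θ _ => ?_
      rw [hterm, norm_mul, hnorm, one_mul])
    (.of_forall fun _ _ => hb.norm) intervalIntegrable_const
    (.of_forall fun θ _ => (hg θ).mul_left _)
  simp only [hterm, intervalIntegral.integral_mul_const, integral_exp_int_mul_I] at h
  refine h.unique ?_
  convert! hasSum_ite_eq j (2 * Real.pi * b j) using 2 with k
  by_cases hk : k = j
  · simp [hk]
  · have : j - k ≠ 0 := fun h => hk (by omega)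
    simp [hk, this]

variable {H : Type u} [NormedAddCommGroup H] [InnerProductSpace ℂ H] [CompleteSpace H]

/-- The Taylor coefficients at the origin, extended to negative indices by taking adjoints. -/
def toeplitzSymbol (F : ℂ → H →L[ℂ] H) (k : ℤ) : H →L[ℂ] H :=
  if 0 ≤ k then ((k.toNat.factorial : ℂ))⁻¹ • iteratedDeriv k.toNat F 0
  else ContinuousLinearMap.adjoint
    ((((-k).toNat.factorial : ℂ))⁻¹ • iteratedDeriv (-k).toNat F 0)

theorem toeplitzSymbol_natCast (F : ℂ → H →L[ℂ] H) (n : ℕ) :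
    toeplitzSymbol F n = (n.factorial : ℂ)⁻¹ • iteratedDeriv n F 0 := by
  simp [toeplitzSymbol]

theorem toeplitzSymbol_zero {F : ℂ → H →L[ℂ] H} (h0 : F 0 = 1) : toeplitzSymbol F 0 = 1 := by
  simp [toeplitzSymbol, h0]

theorem toeplitzSymbol_neg {F : ℂ → H →L[ℂ] H} (h0 : F 0 = 1) (k : ℤ) :
    toeplitzSymbol F (-k) = ContinuousLinearMap.adjoint (toeplitzSymbol F k) := by
  rcases lt_trichotomy k 0 with hk | hk | hk
  · rw [toeplitzSymbol, if_pos (by omega), toeplitzSymbol, if_neg (by omega),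
      ContinuousLinearMap.adjoint_adjoint]
  · have := ContinuousLinearMap.star_eq_adjoint (1 : H →L[ℂ] H)
    rw [star_one] at this
    rw [hk, neg_zero, toeplitzSymbol_zero h0]
    exact this
  · rw [toeplitzSymbol, if_neg (by omega), toeplitzSymbol, if_pos (by omega), neg_neg]

theorem hasSum_toeplitzSymbol {F : ℂ → H →L[ℂ] H} (hF : DifferentiableOn ℂ F (Metric.ball 0 1))
    {z : ℂ} (hz : ‖z‖ < 1) : HasSum (fun n : ℕ => z ^ n • toeplitzSymbol F n) (F z) := by
  have h := hasSum_taylorSeries_on_ball hF (z := z) (by simpa using hz)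
  simp only [sub_zero] at h
  convert! h using 2 with n
  rw [toeplitzSymbol_natCast, smul_comm]

/-- This is the Fourier series of the form of F + F* - 1 on the circle of radius r. The constant
term occurs in both F and F*, so one copy is subtracted. The inner product is conjugate-linear in
its first argument, whence the sign in the exponent. -/
theorem hasSum_inner_toeplitzSymbol {F : ℂ → H →L[ℂ] H} (h0 : F 0 = 1)
    (hF : DifferentiableOn ℂ F (Metric.ball 0 1)) {r : ℝ} (hr0 : 0 ≤ r) (hr : r < 1) (θ : ℝ)
    (x y : H) :
    HasSum (fun k : ℤ => exp (-(k * I * θ)) *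
        ((r : ℂ) ^ k.natAbs * inner ℂ (toeplitzSymbol F k x) y))
      (inner ℂ (F (r * exp (θ * I)) x) y + inner ℂ x (F (r * exp (θ * I)) y) - inner ℂ x y) := by
  have hz : ‖(r : ℂ) * exp (θ * I)‖ < 1 := by
    rw [norm_mul, norm_exp_ofReal_mul_I, mul_one, norm_real, Real.norm_of_nonneg hr0]
    exact hr
  have h := hasSum_toeplitzSymbol hF hz
  have happ : ∀ v, HasSum (fun n : ℕ => ((r : ℂ) * exp (θ * I)) ^ n • toeplitzSymbol F n v)
      (F (r * exp (θ * I)) v) := fun v => by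
    simpa using h.mapL (ContinuousLinearMap.apply ℂ H v)
  have h1 : HasSum (fun n : ℕ => exp (-(((n : ℤ) : ℂ) * I * θ)) *
      ((r : ℂ) ^ (n : ℤ).natAbs * inner ℂ (toeplitzSymbol F n x) y))
      (inner ℂ (F (r * exp (θ * I)) x) y) := by
    have := (((happ x).mapL (innerSL ℂ y)).map (starRingEnd ℂ).toAddMonoidHom continuous_conj)
    convert! this using 1
    · ext n
      simp only [Function.comp_apply, innerSL_apply_apply, RingHom.toAddMonoidHom_eq_coe,
        AddMonoidHom.coe_coe, inner_smul_right, map_mul, map_pow, inner_conj_symm, mul_pow,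
        conj_ofReal, ← exp_conj, conj_I, ← exp_nat_mul, map_natCast, Int.natAbs_natCast, Int.cast_natCast]
      rw [show (n : ℂ) * (θ * -I) = -(n * I * θ) by ring]
      ring
    · simp
  have h2 : HasSum (fun n : ℕ => exp (-(((-(n : ℤ) : ℤ) : ℂ) * I * θ)) *
      ((r : ℂ) ^ (-(n : ℤ)).natAbs * inner ℂ (toeplitzSymbol F (-(n : ℤ)) x) y))
      (inner ℂ x (F (r * exp (θ * I)) y)) := by
    have := ((happ y).mapL (innerSL ℂ x))
    convert! this using 1
    ext n
    simp only [innerSL_apply_apply, inner_smul_right, toeplitzSymbol_neg h0,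
      ContinuousLinearMap.adjoint_inner_left, mul_pow, ← exp_nat_mul, Int.natAbs_neg,
      Int.natAbs_natCast, Int.cast_neg, Int.cast_natCast]
    rw [show (n : ℂ) * (θ * I) = -(-n * I * θ) by ring]
    ring
  have h3 := HasSum.of_nat_of_neg (f := fun k : ℤ => exp (-(k * I * θ)) *
    ((r : ℂ) ^ k.natAbs * inner ℂ (toeplitzSymbol F k x) y)) h1 h2
  simpa [toeplitzSymbol_zero h0] using h3

/-- After weighting the terms by r^|m-n|, the sum is, up to the factor 2π, the integral over the
circle of radius r of the nonnegative form F + F* - 1 at a trigonometric polynomial with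
coefficients v. Letting r tend to 1 removes the weights. -/
theorem toeplitzSymbol_posDef {F : ℂ → H →L[ℂ] H} (h0 : F 0 = 1)
    (hF : DifferentiableOn ℂ F (Metric.ball 0 1))
    (hpos : ∀ z ∈ Metric.ball (0 : ℂ) 1, ∀ x, ‖x‖ ^ 2 ≤ 2 * (inner ℂ (F z x) x).re)
    (v : ℤ →₀ H) :
    0 ≤ (v.sum fun m x => v.sum fun n y => inner ℂ (toeplitzSymbol F (m - n) x) y).re := by
  let f : ℝ → ℝ := fun r => (v.sum fun m x => v.sum fun n y =>
    (r : ℂ) ^ (m - n).natAbs * inner ℂ (toeplitzSymbol F (m - n) x) y).re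
  have hf : Continuous f := by
    simp only [f, Finsupp.sum]
    fun_prop
  have hnonneg : ∀ r ∈ Set.Ioo (0 : ℝ) 1, 0 ≤ f r := by
    rintro r ⟨hr0, hr⟩
    let p : ℝ → H → H → ℂ := fun θ x y =>
      inner ℂ (F (r * exp (θ * I)) x) y + inner ℂ x (F (r * exp (θ * I)) y) - inner ℂ x y
    have hmem : ∀ θ : ℝ, (r : ℂ) * exp (θ * I) ∈ Metric.ball (0 : ℂ) 1 := fun θ => by
      simpa [norm_exp_ofReal_mul_I, abs_of_pos hr0] using hr
    have hpc : ∀ x y, Continuous fun θ => p θ x y := by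
      intro x y
      have : Continuous fun θ : ℝ => F (r * exp (θ * I)) :=
        hF.continuousOn.comp_continuous (by fun_prop) hmem
      exact (((this.clm_apply continuous_const).inner continuous_const).add
        (continuous_const.inner (this.clm_apply continuous_const))).sub continuous_const
    have hint : ∀ m n : ℤ, ∫ θ in (0 : ℝ)..2 * Real.pi,
        exp ((m - n : ℤ) * I * θ) * p θ (v m) (v n) = 2 * Real.pi *
          ((r : ℂ) ^ (m - n).natAbs * inner ℂ (toeplitzSymbol F (m - n) (v m)) (v n)) := by
      intro m n
      have hs := hasSum_inner_toeplitzSymbol h0 hF hr0.le hr (x := v m) (y := v n)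
      refine integral_exp_mul_of_hasSum
        (b := fun k => (r : ℂ) ^ k.natAbs * inner ℂ (toeplitzSymbol F k (v m)) (v n)) ?_ hs (m - n)
      simpa using (hs 0).summable
    -- Expanding the form at this vector produces the factors exp(i(m - n)θ) that extract the
    -- Fourier coefficient of index m - n.
    let w : ℝ → H := fun θ => v.sum fun m x => exp (-(m * I * θ)) • x
    have hw : ∀ θ, p θ (w θ) (w θ) = v.sum fun m x => v.sum fun n y =>
        exp ((m - n : ℤ) * I * θ) * p θ x y := by
      intro θ
      simp only [p, w, Finsupp.sum, map_sum, sum_inner, inner_sum, map_smul, inner_smul_left,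
        inner_smul_right, ← exp_conj, Finset.mul_sum, ← Finset.sum_add_distrib,
        ← Finset.sum_sub_distrib]
      rw [Finset.sum_comm]
      refine Finset.sum_congr rfl fun m _ => Finset.sum_congr rfl fun n _ => ?_
      have : exp ((m - n : ℤ) * I * θ) = exp (conj (-(m * I * θ))) * exp (-(n * I * θ)) := by
        rw [← exp_add]
        congr 1
        simp
        ring
      rw [this]
      ring
    have hre : ∀ θ, 0 ≤ (p θ (w θ) (w θ)).re := by
      intro θ
      have h := hpos _ (hmem θ) (w θ)
      have h1 : (inner ℂ (w θ) (F (r * exp (θ * I)) (w θ))).re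
          = (inner ℂ (F (r * exp (θ * I)) (w θ)) (w θ)).re := by
        rw [← inner_conj_symm, conj_re]
      have h2 : (inner ℂ (w θ) (w θ)).re = ‖w θ‖ ^ 2 := by
        exact inner_self_eq_norm_sq (𝕜 := ℂ) (w θ)
      simp only [p, add_re, sub_re, h1, h2]
      linarith
    have hI : ∫ θ in (0 : ℝ)..2 * Real.pi, p θ (w θ) (w θ) = 2 * Real.pi *
        (v.sum fun m x => v.sum fun n y =>
          (r : ℂ) ^ (m - n).natAbs * inner ℂ (toeplitzSymbol F (m - n) x) y) := by
      simp only [hw, Finsupp.sum]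
      have hc : ∀ m n : ℤ, Continuous fun θ : ℝ => exp ((m - n : ℤ) * I * θ) * p θ (v m) (v n) :=
        fun m n => (by fun_prop : Continuous fun θ : ℝ => exp ((m - n : ℤ) * I * θ)).mul
          (hpc _ _)
      rw [intervalIntegral.integral_finsetSum fun m _ =>
        (continuous_finsetSum _ fun n _ => hc m n).intervalIntegrable _ _, Finset.mul_sum]
      refine Finset.sum_congr rfl fun m _ => ?_
      rw [intervalIntegral.integral_finsetSum fun n _ => (hc m n).intervalIntegrable _ _,
        Finset.mul_sum]
      exact Finset.sum_congr rfl fun n _ => hint m n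
    have hcont : Continuous fun θ => p θ (w θ) (w θ) := by
      simp only [hw, Finsupp.sum]
      exact continuous_finsetSum _ fun m _ => continuous_finsetSum _ fun n _ =>
        (by fun_prop : Continuous fun θ : ℝ => exp ((m - n : ℤ) * I * θ)).mul (hpc _ _)
    have hre2 : 0 ≤ (∫ θ in (0 : ℝ)..2 * Real.pi, p θ (w θ) (w θ)).re := by
      have : (∫ θ in (0 : ℝ)..2 * Real.pi, p θ (w θ) (w θ)).re
          = ∫ θ in (0 : ℝ)..2 * Real.pi, (p θ (w θ) (w θ)).re :=
        (reCLM.intervalIntegral_comp_comm (hcont.intervalIntegrable _ _)).symm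
      rw [this]
      exact intervalIntegral.integral_nonneg (by positivity) fun θ _ => hre θ
    rw [hI] at hre2
    have : ((2 * Real.pi : ℝ) : ℂ) = 2 * Real.pi := by push_cast; ring
    rw [← this, re_ofReal_mul] at hre2
    exact nonneg_of_mul_nonneg_right hre2 (by positivity)
  have hlim : Tendsto f (𝓝[<] 1) (𝓝 (f 1)) := hf.continuousAt.tendsto.mono_left nhdsWithin_le_nhds
  have h1 := ge_of_tendsto hlim (by
    filter_upwards [Ioo_mem_nhdsLT (zero_lt_one (α := ℝ))] with r hr using hnonneg r hr)
  simpa [f] using h1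

end Toeplitz

/-! ### From a contractive function to a unitary extension -/

section Realization

theorem norm_smul_lt_one {A : Type*} [SeminormedAddCommGroup A] [NormedSpace ℂ A] {a : A}
    (ha : ‖a‖ ≤ 1) {z : ℂ} (hz : ‖z‖ < 1) : ‖z • a‖ < 1 := by
  rw [norm_smul]
  exact (mul_le_of_le_one_right (norm_nonneg z) ha).trans_lt hz

theorem isUnit_one_sub_smul {A : Type*} [NormedRing A] [NormedAlgebra ℂ A]
    [HasSummableGeomSeries A] {a : A} (ha : ‖a‖ ≤ 1) {z : ℂ} (hz : ‖z‖ < 1) :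
    IsUnit (1 - z • a) :=
  isUnit_one_sub_of_norm_lt_one (norm_smul_lt_one ha hz)

theorem hasSum_inverse_one_sub {A : Type*} [NormedRing A] [HasSummableGeomSeries A] {t : A}
    (ht : ‖t‖ < 1) : HasSum (fun n : ℕ => t ^ n) (Ring.inverse (1 - t)) := by
  rw [NormedRing.inverse_one_sub t ht]
  exact (HasSummableGeomSeries.summable_geometric_of_norm_lt_one t ht).hasSum

theorem norm_linearIsometryEquiv_le {K : Type*} [NormedAddCommGroup K] [InnerProductSpace ℂ K]
    (U : K ≃ₗᵢ[ℂ] K) : ‖(U : K →L[ℂ] K)‖ ≤ 1 :=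
  ContinuousLinearMap.opNorm_le_bound _ zero_le_one fun x => by simp

theorem analyticAt_ringInverse {A : Type*} [NormedRing A] [NormedAlgebra ℂ A]
    [HasSummableGeomSeries A] {f : ℂ → A} {z : ℂ} (hf : AnalyticAt ℂ f z) (hz : IsUnit (f z)) :
    AnalyticAt ℂ (fun w => Ring.inverse (f w)) z := by
  obtain ⟨a, ha⟩ := hz
  have := analyticAt_inverse (𝕜 := ℂ) a
  rw [ha] at this
  exact this.comp hf

variable {H : Type u} [NormedAddCommGroup H] [InnerProductSpace ℂ H] [CompleteSpace H]

/-- `2 Re (1 - T)⁻¹ ≥ 1` for a strict contraction `T`. -/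
theorem norm_sq_le_re_inner_inverse {T : H →L[ℂ] H} (hT : ‖T‖ < 1) (x : H) :
    ‖x‖ ^ 2 ≤ 2 * (inner ℂ (Ring.inverse (1 - T) x) x).re := by
  have hu : IsUnit (1 - T) := isUnit_one_sub_of_norm_lt_one hT
  set y := Ring.inverse (1 - T) x with hy
  have hx : x = y - T y := by
    have := congrArg (fun A : H →L[ℂ] H => A x) (Ring.mul_inverse_cancel _ hu)
    simpa [← hy] using this.symm
  have hTy : ‖T y‖ ≤ ‖y‖ := by
    simpa using T.le_of_opNorm_le hT.le y
  -- With x = y - Ty, the difference of the two sides is ‖y‖² - ‖Ty‖².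
  have h1 := norm_sub_sq (𝕜 := ℂ) y (T y)
  have h2 : (inner ℂ y x).re = ‖y‖ ^ 2 - (inner ℂ y (T y)).re := by
    rw [hx, inner_sub_right, sub_re]
    congr 1
    exact inner_self_eq_norm_sq (𝕜 := ℂ) y
  rw [h2, hx, h1]
  simp only [RCLike.re_to_complex]
  nlinarith [norm_nonneg (T y)]

/-- Every contractive analytic function with values in the extensions of `V` is realized by a
unitary extension of `V`. -/
theorem exists_unitaryExtension [TopologicalSpace.SeparableSpace H] {V : H →ₗ.[ℂ] H}
    (hV : IsIsometric V) {S : ℂ → H →L[ℂ] H} (hS : AnalyticOnNhd ℂ S (Metric.ball 0 1))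
    (hS1 : ∀ z ∈ Metric.ball (0 : ℂ) 1, ‖S z‖ ≤ 1) (hSV : ∀ x : V.domain, S 0 x = V x) :
    ∃ W : UnitaryExtension V, ∀ ζ : UnitDisc,
      W.resolvent (discPoint ζ) = Ring.inverse (1 - (ζ : ℂ) • S ζ) := by
  let F : ℂ → H →L[ℂ] H := fun z => Ring.inverse (1 - z • S z)
  have hunit : ∀ z ∈ Metric.ball (0 : ℂ) 1, IsUnit (1 - z • S z) := fun z hz =>
    isUnit_one_sub_smul (hS1 z hz) (by simpa using hz)
  have hF : AnalyticOnNhd ℂ F (Metric.ball 0 1) := fun z hz =>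
    analyticAt_ringInverse (analyticAt_const.sub (analyticAt_id.smul (hS z hz))) (hunit z hz)
  have h0 : F 0 = 1 := by simp [F]
  have hpos : ∀ z ∈ Metric.ball (0 : ℂ) 1, ∀ x, ‖x‖ ^ 2 ≤ 2 * (inner ℂ (F z x) x).re :=
    fun z hz x => norm_sq_le_re_inner_inverse
      (norm_smul_lt_one (hS1 z hz) (by simpa using hz)) x
  have hmem0 : (0 : ℂ) ∈ Metric.ball (0 : ℂ) 1 := by simp
  -- From F = 1 + z S F one reads off F'(0) = S(0). Hence only the value of S at the origin has to
  -- extend V.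
  have hc1 : toeplitzSymbol F 1 = S 0 := by
    have hderiv : deriv F 0 = S 0 := by
      have h1 : HasDerivAt (fun z => (1 : H →L[ℂ] H) + z • (S z * F z)) (S 0 * F 0) 0 := by
        have := (hasDerivAt_id (0 : ℂ)).smul
          ((hS 0 hmem0).mul (hF 0 hmem0)).differentiableAt.hasDerivAt
        simpa using this.const_add (1 : H →L[ℂ] H)
      have h2 : F =ᶠ[𝓝 0] fun z => (1 : H →L[ℂ] H) + z • (S z * F z) := by
        filter_upwards [Metric.isOpen_ball.mem_nhds hmem0] with z hz
        have := Ring.mul_inverse_cancel _ (hunit z hz)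
        rw [sub_mul, one_mul, smul_mul_assoc, sub_eq_iff_eq_add] at this
        exact this
      rw [(h1.congr_of_eventuallyEq h2).deriv, h0, mul_one]
    have := toeplitzSymbol_natCast F 1
    simpa [hderiv] using this
  obtain ⟨K, _, _, _, _, J, U, hU⟩ := exists_unitary_of_posDef (toeplitzSymbol F)
    (toeplitzSymbol_zero h0) (toeplitzSymbol_neg h0)
    (toeplitzSymbol_posDef h0 hF.differentiableOn hpos)
  have hext : ∀ x : V.domain, U (J x) = J (V x) := by
    intro x
    -- U J x and J V x have equal norms, and their inner product is the square of that norm, so they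
    -- coincide.
    have h1 : inner ℂ (U (J x)) (J (V x)) = inner ℂ (V x) (V x) := by
      have := hU 1 x (V x)
      simpa [hc1, hSV] using this
    have h2 := norm_sub_sq (𝕜 := ℂ) (U (J x)) (J (V x))
    rw [h1, inner_self_eq_norm_sq (𝕜 := ℂ)] at h2
    simp only [LinearIsometryEquiv.norm_map, LinearIsometry.norm_map, hV x] at h2
    have h3 : ‖U (J x) - J (V x)‖ ^ 2 = 0 := by rw [h2]; ring
    exact sub_eq_zero.mp (norm_eq_zero.mp (pow_eq_zero_iff two_ne_zero |>.mp h3))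
  let W : UnitaryExtension V := { K := K, J := J, U := U, extends_V := hext }
  refine ⟨W, fun ζ => ?_⟩
  ext x
  refine ext_inner_right ℂ fun y => ?_
  have hs1 := (hasSum_inverse_one_sub
    (norm_smul_lt_one (norm_linearIsometryEquiv_le U) ζ.norm_lt_one)).mapL
      (ContinuousLinearMap.apply ℂ K (J x))
  have hs2 := (hasSum_toeplitzSymbol hF.differentiableOn ζ.norm_lt_one).mapL
    (ContinuousLinearMap.apply ℂ H x)
  -- Both sides are sums of power series in ζ with the same coefficients, by the dilation property.
  have hs : ContinuousLinearMap.adjoint J.toContinuousLinearMap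
      (Ring.inverse (1 - (ζ : ℂ) • (U : K →L[ℂ] K)) (J x)) = F ζ x := by
    refine (hs1.mapL (ContinuousLinearMap.adjoint J.toContinuousLinearMap)).unique ?_
    convert! hs2 using 2 with n
    refine ext_inner_right ℂ fun y => ?_
    have := hU n x y
    simp only [ContinuousLinearMap.apply_apply, smul_pow, map_smul, inner_smul_left,
      ContinuousLinearMap.adjoint_inner_left]
    rw [← this]
    rfl
  exact congrArg (inner ℂ · y) hs

end Realization

/-! ### From a unitary extension to a contractive function -/

section Characteristic

section Embedding

variable {H K : Type*} [NormedAddCommGroup H] [InnerProductSpace ℂ H] [CompleteSpace H]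
  [NormedAddCommGroup K] [InnerProductSpace ℂ K] [CompleteSpace K] (J : H →ₗᵢ[ℂ] K)

theorem adjoint_apply_linearIsometry (x : H) :
    ContinuousLinearMap.adjoint J.toContinuousLinearMap (J x) = x := by
  refine ext_inner_right ℂ fun y => ?_
  rw [ContinuousLinearMap.adjoint_inner_left]
  exact J.inner_map_map x y

/-- The orthogonal projection onto the complement of the range of an isometric embedding. -/
def complementProjection : K →L[ℂ] K :=
  1 - J.toContinuousLinearMap ∘L ContinuousLinearMap.adjoint J.toContinuousLinearMap

theorem complementProjection_apply (w : K) : complementProjection J w =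
    w - J (ContinuousLinearMap.adjoint J.toContinuousLinearMap w) := rfl

theorem adjoint_complementProjection (w : K) :
    ContinuousLinearMap.adjoint J.toContinuousLinearMap (complementProjection J w) = 0 := by
  rw [complementProjection_apply, map_sub, adjoint_apply_linearIsometry, sub_self]

theorem complementProjection_embedding (x : H) : complementProjection J (J x) = 0 := by
  rw [complementProjection_apply, adjoint_apply_linearIsometry, sub_self]

theorem norm_sq_add_complementProjection (h : H) (a : ℂ) (w : K) :
    ‖J h + a • complementProjection J w‖ ^ 2
      = ‖h‖ ^ 2 + ‖a‖ ^ 2 * ‖complementProjection J w‖ ^ 2 := by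
  have horth : inner ℂ (J h) (a • complementProjection J w) = 0 := by
    have := ContinuousLinearMap.adjoint_inner_right J.toContinuousLinearMap h
      (complementProjection J w)
    rw [adjoint_complementProjection, inner_zero_right] at this
    rw [inner_smul_right]
    exact mul_eq_zero_of_right _ this.symm
  have := norm_add_sq_eq_norm_sq_add_norm_sq_of_inner_eq_zero _ _ horth
  rw [sq, this, norm_smul, J.norm_map]
  ring

theorem norm_sq_eq_adjoint_add_complementProjection (w : K) :
    ‖w‖ ^ 2 = ‖ContinuousLinearMap.adjoint J.toContinuousLinearMap w‖ ^ 2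
      + ‖complementProjection J w‖ ^ 2 := by
  have := norm_sq_add_complementProjection J
    (ContinuousLinearMap.adjoint J.toContinuousLinearMap w) 1 w
  simpa [complementProjection_apply] using this

theorem norm_complementProjection_le : ‖complementProjection J‖ ≤ 1 := by
  refine ContinuousLinearMap.opNorm_le_bound _ zero_le_one fun w => ?_
  rw [one_mul]
  refine le_of_sq_le_sq ?_ (norm_nonneg w)
  rw [norm_sq_eq_adjoint_add_complementProjection J w]
  exact le_add_of_nonneg_left (sq_nonneg _)

end Embedding

section Unitary

variable {K : Type*} [NormedAddCommGroup K] [InnerProductSpace ℂ K]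
  (U : K ≃ₗᵢ[ℂ] K)

theorem mul_symm_linearIsometryEquiv : (U : K →L[ℂ] K) * (U.symm : K →L[ℂ] K) = 1 := by
  ext x
  simp

theorem symm_mul_linearIsometryEquiv : (U.symm : K →L[ℂ] K) * (U : K →L[ℂ] K) = 1 := by
  ext x
  simp

theorem isUnit_linearIsometryEquiv : IsUnit (U : K →L[ℂ] K) :=
  ⟨⟨U, U.symm, mul_symm_linearIsometryEquiv U, symm_mul_linearIsometryEquiv U⟩, rfl⟩

variable [CompleteSpace K]

theorem star_linearIsometryEquiv : star (U : K →L[ℂ] K) = (U.symm : K →L[ℂ] K) :=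
  U.adjoint_eq_symm

/-- Outside the closed disc, 1 - zU = (-zU)(1 - z⁻¹U⁻¹), and the second factor is a Neumann series.
-/
theorem isUnit_one_sub_smul_unitary {z : ℂ} (hz : ‖z‖ ≠ 1) :
    IsUnit (1 - z • (U : K →L[ℂ] K)) := by
  rcases lt_or_gt_of_ne hz with h | h
  · exact isUnit_one_sub_smul (norm_linearIsometryEquiv_le U) h
  · have hz0 : z ≠ 0 := by
      rintro rfl
      simp at h
      linarith
    have hu : IsUnit (1 - z⁻¹ • (U.symm : K →L[ℂ] K)) :=
      isUnit_one_sub_smul (norm_linearIsometryEquiv_le U.symm) (by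
        rw [norm_inv]
        exact inv_lt_one_of_one_lt₀ h)
    have hU : IsUnit ((-z) • (U : K →L[ℂ] K)) := by
      have := (isUnit_linearIsometryEquiv U).smul (Units.mk0 (-z) (neg_ne_zero.mpr hz0))
      exact this
    convert hU.mul hu using 1
    rw [mul_sub, smul_mul_smul_comm, mul_symm_linearIsometryEquiv, neg_mul,
      mul_inv_cancel₀ hz0]
    simp
    abel

/-- As U* = U⁻¹, the adjoint of 1 - z̄⁻¹U is 1 - z⁻¹U⁻¹, whose inverse is -zU(1 - zU)⁻¹. This
symmetry makes a generalized resolvent on the disc determine it outside. -/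
theorem star_inverse_one_sub_reflected {z : ℂ} (hz0 : z ≠ 0) (hz : ‖z‖ ≠ 1) :
    star (Ring.inverse (1 - (conj z)⁻¹ • (U : K →L[ℂ] K)))
      = 1 - Ring.inverse (1 - z • (U : K →L[ℂ] K)) := by
  set A := 1 - z • (U : K →L[ℂ] K) with hA
  set B := 1 - (conj z)⁻¹ • (U : K →L[ℂ] K) with hB
  have hAu : IsUnit A := isUnit_one_sub_smul_unitary U hz
  have hBu : IsUnit B := isUnit_one_sub_smul_unitary U (by
    rw [norm_inv, norm_conj]
    exact fun h => hz (inv_eq_one.mp h))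
  have hBs : star B = 1 - z⁻¹ • (U.symm : K →L[ℂ] K) := by
    rw [hB, star_sub, star_one, star_smul, star_linearIsometryEquiv]
    simp
  have h1 : star B * (z • (U : K →L[ℂ] K)) = -A := by
    rw [hBs, sub_mul, smul_mul_smul_comm, symm_mul_linearIsometryEquiv, inv_mul_cancel₀ hz0, hA]
    simp
  have h2 : star B * (1 - Ring.inverse A) = 1 := by
    have h3 : 1 - Ring.inverse A = -(z • (U : K →L[ℂ] K)) * Ring.inverse A := by
      calc 1 - Ring.inverse A = A * Ring.inverse A - 1 * Ring.inverse A := by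
            rw [Ring.mul_inverse_cancel _ hAu, one_mul]
        _ = -(z • (U : K →L[ℂ] K)) * Ring.inverse A := by
            rw [← sub_mul, hA]
            congr 1
            abel
    rw [h3, ← mul_assoc, mul_neg, h1, neg_neg, Ring.mul_inverse_cancel _ hAu]
  have h4 : star (Ring.inverse B) * star B = 1 := by
    rw [← star_mul, Ring.mul_inverse_cancel _ hBu, star_one]
  calc star (Ring.inverse B) = star (Ring.inverse B) * (star B * (1 - Ring.inverse A)) := by
        rw [h2, mul_one]
    _ = 1 - Ring.inverse A := by rw [← mul_assoc, h4, one_mul]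

end Unitary

variable {H : Type u} [NormedAddCommGroup H] [InnerProductSpace ℂ H] [CompleteSpace H]

namespace UnitaryExtension

variable {V : H →ₗ.[ℂ] H} (W : UnitaryExtension V)

/-- The compression to `H` of an operator in the larger space. -/
def compress : (W.K →L[ℂ] W.K) →L[ℂ] H →L[ℂ] H :=
  (ContinuousLinearMap.compL ℂ H W.K H
    (ContinuousLinearMap.adjoint W.J.toContinuousLinearMap)) ∘L
    (ContinuousLinearMap.compL ℂ H W.K W.K).flip W.J.toContinuousLinearMap

theorem compress_apply (A : W.K →L[ℂ] W.K) (x : H) :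
    W.compress A x = ContinuousLinearMap.adjoint W.J.toContinuousLinearMap (A (W.J x)) := rfl

theorem compress_one : W.compress 1 = 1 := by
  ext x
  rw [compress_apply]
  exact adjoint_apply_linearIsometry W.J x

theorem compress_star (A : W.K →L[ℂ] W.K) : W.compress (star A) = star (W.compress A) := by
  ext x
  refine ext_inner_right ℂ fun y => ?_
  simp only [ContinuousLinearMap.star_eq_adjoint, compress_apply,
    ContinuousLinearMap.adjoint_inner_left, ContinuousLinearMap.adjoint_inner_right]
  rfl

theorem resolvent_eq (ζ : OffCircle) :
    W.resolvent ζ = W.compress (Ring.inverse (1 - (ζ : ℂ) • (W.U : W.K →L[ℂ] W.K))) := rfl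

theorem continuousAt_compress_inverse {z : ℂ} (hz : ‖z‖ ≠ 1) :
    ContinuousAt (fun w => W.compress (Ring.inverse (1 - w • (W.U : W.K →L[ℂ] W.K)))) z := by
  have h : AnalyticAt ℂ (fun w : ℂ => Ring.inverse (1 - w • (W.U : W.K →L[ℂ] W.K))) z :=
    analyticAt_ringInverse (analyticAt_const.sub (analyticAt_id.smul analyticAt_const))
      (isUnit_one_sub_smul_unitary W.U hz)
  exact W.compress.continuous.continuousAt.comp h.continuousAt

theorem resolvent_reflect {z w : OffCircle} (hz : (z : ℂ) ≠ 0) (hw : (w : ℂ) = (conj (z : ℂ))⁻¹) :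
    W.resolvent w = 1 - star (W.resolvent z) := by
  have h := congrArg star (star_inverse_one_sub_reflected W.U hz z.2)
  rw [star_star, star_sub, star_one] at h
  rw [resolvent_eq, resolvent_eq, hw, h, map_sub, compress_one, compress_star]

/-- Generalized resolvents that coincide in the unit disc coincide. -/
theorem resolvent_ext {V' : H →ₗ.[ℂ] H} {W : UnitaryExtension V} {W' : UnitaryExtension V'}
    (h : ∀ ζ : UnitDisc, W.resolvent (discPoint ζ) = W'.resolvent (discPoint ζ)) :
    W.resolvent = W'.resolvent := by
  funext ζ
  rcases lt_or_gt_of_ne ζ.2 with hζ | hζ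
  · exact h (UnitDisc.mk ζ hζ)
  · have hζ0 : (ζ : ℂ) ≠ 0 := by
      intro h0
      rw [h0] at hζ
      simp at hζ
      linarith
    have hw : ‖(conj (ζ : ℂ))⁻¹‖ < 1 := by
      rw [norm_inv, norm_conj]
      exact inv_lt_one_of_one_lt₀ hζ
    have hw0 : ((discPoint (UnitDisc.mk _ hw) : OffCircle) : ℂ) ≠ 0 := by
      simpa [discPoint] using hζ0
    have hζw : (ζ : ℂ) = (conj ((discPoint (UnitDisc.mk _ hw) : OffCircle) : ℂ))⁻¹ := by
      simp [discPoint]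
    rw [W.resolvent_reflect hw0 hζw, W'.resolvent_reflect hw0 hζw, h]

/-- The characteristic function of a unitary extension: an analytic function in the disc whose
values are contractive extensions of `V`, which determines the generalized resolvent. -/
theorem exists_contractive_extension :
    ∃ S : ℂ → H →L[ℂ] H, AnalyticOnNhd ℂ S (Metric.ball 0 1) ∧
      (∀ z ∈ Metric.ball (0 : ℂ) 1, ‖S z‖ ≤ 1) ∧
      (∀ z ∈ Metric.ball (0 : ℂ) 1, ∀ x : V.domain, S z x = V x) ∧
      ∀ ζ : UnitDisc, W.resolvent (discPoint ζ) = Ring.inverse (1 - (ζ : ℂ) • S ζ) := by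
  let U : W.K →L[ℂ] W.K := W.U
  let Q := complementProjection W.J
  have hQU : ‖Q * U‖ ≤ 1 := (norm_mul_le _ _).trans
    (mul_le_one₀ (norm_complementProjection_le W.J) (norm_nonneg _)
      (norm_linearIsometryEquiv_le W.U))
  have hunit : ∀ z ∈ Metric.ball (0 : ℂ) 1, IsUnit (1 - z • (Q * U)) := fun z hz =>
    isUnit_one_sub_smul hQU (by simpa using hz)
  let Y : ℂ → W.K →L[ℂ] W.K := fun z => Ring.inverse (1 - z • (Q * U))
  -- Y z h solves y = h + z Q U y: its component in H is h, and the other one is z times the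
  -- complementary component of U y.
  let S : ℂ → H →L[ℂ] H := fun z => W.compress (U * Y z)
  have hY : ∀ z ∈ Metric.ball (0 : ℂ) 1, ∀ h : H,
      Y z (W.J h) = W.J h + z • Q (U (Y z (W.J h))) := by
    intro z hz h
    have := congrArg (fun A : W.K →L[ℂ] W.K => A (W.J h)) (Ring.mul_inverse_cancel _ (hunit z hz))
    exact sub_eq_iff_eq_add.mp this
  have hSapp : ∀ z h, S z h
      = ContinuousLinearMap.adjoint W.J.toContinuousLinearMap (U (Y z (W.J h))) := fun _ _ => rfl
  have hS1 : ∀ z ∈ Metric.ball (0 : ℂ) 1, ‖S z‖ ≤ 1 := by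
    intro z hz
    refine ContinuousLinearMap.opNorm_le_bound _ zero_le_one fun h => ?_
    rw [one_mul]
    refine le_of_sq_le_sq ?_ (norm_nonneg h)
    have h1 := norm_sq_eq_adjoint_add_complementProjection W.J (U (Y z (W.J h)))
    have h2 := norm_sq_add_complementProjection W.J h z (U (Y z (W.J h)))
    have h3 : ‖U (Y z (W.J h))‖ = ‖Y z (W.J h)‖ := W.U.norm_map _
    rw [← hY z hz h] at h2
    rw [← hSapp, h3, h2] at h1
    have hz1 : ‖z‖ ^ 2 ≤ 1 := by
      have : ‖z‖ < 1 := by simpa using hz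
      exact pow_le_one₀ (norm_nonneg z) this.le
    nlinarith [sq_nonneg ‖complementProjection W.J (U (Y z (W.J h)))‖]
  refine ⟨S, fun z hz => ?_, hS1, fun z hz x => ?_, fun ζ => ?_⟩
  · exact W.compress.analyticAt _ |>.comp (analyticAt_const.mul
      (analyticAt_ringInverse (analyticAt_const.sub (analyticAt_id.smul analyticAt_const))
        (hunit z hz)))
  -- On D(V) the operator U stays inside H, so Q U vanishes there and Y fixes the vector.
  · have hUJ : U (W.J x) = W.J (V x) := W.extends_V x
    have h1 : (1 - z • (Q * U)) (W.J x) = W.J x := by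
      have : Q (U (W.J x)) = 0 := by rw [hUJ, complementProjection_embedding]
      simp [this]
    have h2 : Y z (W.J x) = W.J x := by
      have := congrArg (fun A : W.K →L[ℂ] W.K => A (W.J x))
        (Ring.inverse_mul_cancel _ (hunit z hz))
      exact (congrArg (Y z) h1).symm.trans this
    rw [hSapp, h2, hUJ, adjoint_apply_linearIsometry]
  · have hz : (ζ : ℂ) ∈ Metric.ball (0 : ℂ) 1 := by simpa using ζ.norm_lt_one
    have hSu : IsUnit (1 - (ζ : ℂ) • S ζ) := isUnit_one_sub_smul (hS1 ζ hz) ζ.norm_lt_one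
    have hUu : IsUnit (1 - (ζ : ℂ) • U) := isUnit_one_sub_smul_unitary W.U ζ.norm_ne_one
    have key : W.resolvent (discPoint ζ) * (1 - (ζ : ℂ) • S ζ) = 1 := by
      ext h
      -- Replacing Q U y by U y - S h in the equation for y moves the whole of U y to the left and
      -- leaves a vector of H on the right.
      have h1 : (1 - (ζ : ℂ) • U) (Y ζ (W.J h)) = W.J ((1 - (ζ : ℂ) • S ζ) h) := by
        have h2 := hY ζ hz h
        have h3 : Q (U (Y ζ (W.J h))) = U (Y ζ (W.J h)) - W.J (S ζ h) :=
          complementProjection_apply W.J _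
        rw [h3, smul_sub] at h2
        have h4 : Y ζ (W.J h) - (ζ : ℂ) • U (Y ζ (W.J h)) = W.J h - (ζ : ℂ) • W.J (S ζ h) := by
          nth_rewrite 1 [h2]
          abel
        simpa using h4
      have h5 : W.resolvent (discPoint ζ) ((1 - (ζ : ℂ) • S ζ) h)
          = ContinuousLinearMap.adjoint W.J.toContinuousLinearMap (Y ζ (W.J h)) := by
        rw [resolvent_eq, compress_apply, ← h1]
        congr 1
        exact congrArg (fun A : W.K →L[ℂ] W.K => A (Y ζ (W.J h)))
          (Ring.inverse_mul_cancel _ hUu)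
      rw [mul_apply_eq_comp, h5, hY ζ hz h, map_add, map_smul, adjoint_complementProjection,
        adjoint_apply_linearIsometry, smul_zero, add_zero]
      rfl
    calc W.resolvent (discPoint ζ)
        = W.resolvent (discPoint ζ) * ((1 - (ζ : ℂ) • S ζ)
            * Ring.inverse (1 - (ζ : ℂ) • S ζ)) := by
          rw [Ring.mul_inverse_cancel _ hSu, mul_one]
      _ = Ring.inverse (1 - (ζ : ℂ) • S ζ) := by rw [← mul_assoc, key, one_mul]

end UnitaryExtension

end Characteristic

/-! ### Graphs of partially defined operators and the transform of V -/

section LinearFractional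

section Graph

variable {H : Type*} [NormedAddCommGroup H] [InnerProductSpace ℂ H]

theorem mem_graph_add {f g : H →ₗ.[ℂ] H} {a b : H} :
    (a, b) ∈ (f + g).graph ↔ ∃ c d, (a, c) ∈ f.graph ∧ (a, d) ∈ g.graph ∧ b = c + d := by
  simp only [LinearPMap.mem_graph_iff]
  constructor
  · rintro ⟨x, rfl, rfl⟩
    exact ⟨_, _, ⟨⟨x, x.2.1⟩, rfl, rfl⟩, ⟨⟨x, x.2.2⟩, rfl, rfl⟩, rfl⟩
  · rintro ⟨_, _, ⟨x, rfl, rfl⟩, ⟨y, hy, rfl⟩, rfl⟩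
    refine ⟨⟨x, x.2, hy ▸ y.2⟩, rfl, ?_⟩
    rw [LinearPMap.add_apply]
    congr 2
    exact Subtype.ext hy.symm

theorem mem_graph_sub {f g : H →ₗ.[ℂ] H} {a b : H} :
    (a, b) ∈ (f - g).graph ↔ ∃ c d, (a, c) ∈ f.graph ∧ (a, d) ∈ g.graph ∧ b = c - d := by
  simp only [LinearPMap.mem_graph_iff]
  constructor
  · rintro ⟨x, rfl, rfl⟩
    exact ⟨_, _, ⟨⟨x, x.2.1⟩, rfl, rfl⟩, ⟨⟨x, x.2.2⟩, rfl, rfl⟩, rfl⟩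
  · rintro ⟨_, _, ⟨x, rfl, rfl⟩, ⟨y, hy, rfl⟩, rfl⟩
    refine ⟨⟨x, x.2, hy ▸ y.2⟩, rfl, ?_⟩
    rw [LinearPMap.sub_apply]
    congr 2
    exact Subtype.ext hy.symm

theorem mem_graph_smul {f : H →ₗ.[ℂ] H} {z : ℂ} {a b : H} :
    (a, b) ∈ (z • f).graph ↔ ∃ c, (a, c) ∈ f.graph ∧ b = z • c := by
  simp only [LinearPMap.mem_graph_iff]
  constructor
  · rintro ⟨x, rfl, rfl⟩
    exact ⟨_, ⟨x, rfl, rfl⟩, rfl⟩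
  · rintro ⟨_, ⟨x, rfl, rfl⟩, rfl⟩
    exact ⟨x, rfl, rfl⟩

theorem mem_graph_toPMap_top {f : H →ₗ[ℂ] H} {a b : H} :
    (a, b) ∈ (f.toPMap ⊤).graph ↔ b = f a := by
  simp only [LinearPMap.mem_graph_iff]
  constructor
  · rintro ⟨x, rfl, rfl⟩
    rfl
  · rintro rfl
    exact ⟨⟨a, trivial⟩, rfl, rfl⟩

theorem mem_graph_E {a b : H} : (a, b) ∈ (E H).graph ↔ b = a :=
  mem_graph_toPMap_top

theorem mem_graph_product {S T : H →ₗ.[ℂ] H} {a b : H} :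
    (a, b) ∈ (product S T).graph ↔ ∃ c, (a, c) ∈ T.graph ∧ (c, b) ∈ S.graph := by
  have happ : ∀ (x : (product S T).domain) (y : T.domain) (hy : (y : H) = x)
      (h : T y ∈ S.domain), product S T x = S ⟨T y, h⟩ := by
    intro x y hy h
    exact congrArg S (Subtype.ext (LinearPMap.domRestrict_apply hy.symm))
  simp only [LinearPMap.mem_graph_iff]
  constructor
  · rintro ⟨x, rfl, rfl⟩
    obtain ⟨y, hy, hyx⟩ := x.2.1
    exact ⟨T y, ⟨y, hyx, rfl⟩, ⟨T y, hy⟩, rfl, (happ x y hyx hy).symm⟩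
  · rintro ⟨_, ⟨x, rfl, rfl⟩, ⟨y, hy, rfl⟩⟩
    have hx : T x ∈ S.domain := hy ▸ y.2
    have hmem : (x : H) ∈ (product S T).domain := ⟨⟨x, hx, rfl⟩, x.2⟩
    refine ⟨⟨x, hmem⟩, rfl, ?_⟩
    rw [happ ⟨x, hmem⟩ x rfl hx]
    exact congrArg S (Subtype.ext hy.symm)

/-- Without injectivity the swapped graph is not single-valued, and `inverse` cannot have it as its
graph. -/
theorem mem_graph_inverse {f : H →ₗ.[ℂ] H} (hf : ∀ a, (a, (0 : H)) ∈ f.graph → a = 0) {a b : H} :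
    (a, b) ∈ f.inverse.graph ↔ (b, a) ∈ f.graph := by
  have hker : LinearMap.ker f.toFun = ⊥ := by
    rw [LinearMap.ker_eq_bot']
    intro x hx
    exact Subtype.ext (hf x ((LinearPMap.mem_graph_iff f).mpr ⟨x, rfl, hx⟩))
  rw [LinearPMap.inverse_graph hker]
  simp

theorem mem_graph_id_sub_smul {T : H →ₗ.[ℂ] H} {z : ℂ} {a b : H} :
    (a, b) ∈ (E H - z • T).graph ↔ ∃ w, (a, w) ∈ T.graph ∧ b = a - z • w := by
  simp only [mem_graph_sub, mem_graph_smul, mem_graph_E]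
  aesop

theorem mem_graph_id_add_smul {T : H →ₗ.[ℂ] H} {z : ℂ} {a b : H} :
    (a, b) ∈ (E H + z • T).graph ↔ ∃ w, (a, w) ∈ T.graph ∧ b = a + z • w := by
  simp only [mem_graph_add, mem_graph_smul, mem_graph_E]
  aesop

theorem mem_graph_sup {f g : H →ₗ.[ℂ] H}
    (h : ∀ (x : f.domain) (y : g.domain), (x : H) = y → f x = g y) {a b : H} :
    (a, b) ∈ (f.sup g h).graph ↔
      ∃ x w y v, (x, w) ∈ f.graph ∧ (y, v) ∈ g.graph ∧ a = x + y ∧ b = w + v := by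
  simp only [LinearPMap.mem_graph_iff]
  constructor
  · rintro ⟨x, rfl, rfl⟩
    obtain ⟨p, hp, q, hq, hpq⟩ := Submodule.mem_sup.mp x.2
    exact ⟨p, _, q, _, ⟨⟨p, hp⟩, rfl, rfl⟩, ⟨⟨q, hq⟩, rfl, rfl⟩, hpq.symm,
      LinearPMap.sup_apply h ⟨p, hp⟩ ⟨q, hq⟩ x hpq⟩
  · rintro ⟨_, _, _, _, ⟨p, rfl, rfl⟩, ⟨q, rfl, rfl⟩, rfl, rfl⟩
    exact ⟨⟨p + q, Submodule.add_mem_sup p.2 q.2⟩, rfl, LinearPMap.sup_apply h p q _ rfl⟩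

theorem norm_eq_of_mem_graph {V : H →ₗ.[ℂ] H} (hV : IsIsometric V) {x w : H}
    (h : (x, w) ∈ V.graph) : ‖w‖ = ‖x‖ := by
  obtain ⟨y, rfl, rfl⟩ := (LinearPMap.mem_graph_iff V).mp h
  exact hV y

theorem norm_sub_smul_ge {x w : H} (h : ‖w‖ ≤ ‖x‖) (z : ℂ) :
    (1 - ‖z‖) * ‖x‖ ≤ ‖x - z • w‖ := by
  have h1 := norm_sub_norm_le x (z • w)
  rw [norm_smul] at h1
  nlinarith [norm_nonneg z]

theorem eq_zero_of_sub_smul_eq_zero {x w : H} (h : ‖w‖ ≤ ‖x‖) {z : ℂ} (hz : ‖z‖ < 1)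
    (h0 : x - z • w = 0) : x = 0 := by
  have h1 := norm_sub_smul_ge h z
  rw [h0, norm_zero] at h1
  have h2 : ‖x‖ ≤ 0 := by nlinarith [norm_nonneg x]
  exact norm_le_zero_iff.mp h2

/-- Parametrizing V_z by the graph of V eliminates the inverse; everything later about V_z goes
through this form. -/
theorem mem_graph_moebius {V : H →ₗ.[ℂ] H} (hV : IsIsometric V) {z : ℂ} (hz : ‖z‖ < 1) {a b : H} :
    (a, b) ∈ (moebius z V).graph ↔
      ∃ x w, (x, w) ∈ V.graph ∧ a = x - z • w ∧ b = w - conj z • x := by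
  have hinj : ∀ x, (x, (0 : H)) ∈ (E H - z • V).graph → x = 0 := by
    intro x hx
    obtain ⟨w, hw, h0⟩ := mem_graph_id_sub_smul.mp hx
    exact eq_zero_of_sub_smul_eq_zero (norm_eq_of_mem_graph hV hw).le hz h0.symm
  rw [moebius, mem_graph_product]
  simp only [mem_graph_inverse hinj, mem_graph_id_sub_smul]
  simp only [mem_graph_sub, mem_graph_smul, mem_graph_E]
  constructor
  · rintro ⟨x, ⟨w, hw, rfl⟩, w', _, hw', ⟨_, rfl, rfl⟩, rfl⟩
    obtain rfl := V.mem_graph_snd_inj hw hw' rfl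
    exact ⟨_, _, hw, rfl, rfl⟩
  · rintro ⟨x, w, hw, rfl, rfl⟩
    exact ⟨x, ⟨w, hw, rfl⟩, w, _, hw, ⟨x, rfl, rfl⟩, rfl⟩

/-- The basic identity behind linear-fractional transformations of contractions. -/
theorem norm_sub_smul_sq_sub (a b : H) (z : ℂ) :
    ‖a - z • b‖ ^ 2 - ‖b - conj z • a‖ ^ 2 = (1 - ‖z‖ ^ 2) * (‖a‖ ^ 2 - ‖b‖ ^ 2) := by
  have h1 := norm_sub_sq (𝕜 := ℂ) a (z • b)
  have h2 := norm_sub_sq (𝕜 := ℂ) b (conj z • a)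
  have h3 : RCLike.re (inner ℂ a (z • b)) = RCLike.re (inner ℂ b (conj z • a)) := by
    rw [← inner_conj_symm a, RCLike.conj_re, inner_smul_left, inner_smul_right]
  rw [h1, h2, h3, norm_smul, norm_smul, norm_conj]
  ring

end Graph

/-! ### Transforms of unitary operators and their resolvents -/

section UnitaryMoebius

variable {K : Type*} [NormedAddCommGroup K] [InnerProductSpace ℂ K] [CompleteSpace K]

theorem exists_sub_smul_eq {T : K →L[ℂ] K} (hT : ‖T‖ ≤ 1) {z : ℂ} (hz : ‖z‖ < 1) (y : K) :
    ∃ x, x - z • T x = y := by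
  refine ⟨Ring.inverse (1 - z • T) y, ?_⟩
  exact congrArg (fun A : K →L[ℂ] K => A y)
    (Ring.mul_inverse_cancel _ (isUnit_one_sub_smul hT hz))

/-- The linear-fractional transform `(U - z̄) (1 - z U)⁻¹` of a unitary operator is unitary. -/
theorem exists_unitary_moebius (U : K ≃ₗᵢ[ℂ] K) {z : ℂ} (hz : ‖z‖ < 1) :
    ∃ U' : K ≃ₗᵢ[ℂ] K, ∀ x, U' (x - z • U x) = U x - conj z • x := by
  let T : K →L[ℂ] K := U
  have hu : IsUnit (1 - z • T) := isUnit_one_sub_smul (norm_linearIsometryEquiv_le U) hz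
  let A : K →L[ℂ] K := (T - conj z • 1) * Ring.inverse (1 - z • T)
  have hA : ∀ x, A (x - z • U x) = U x - conj z • x := by
    intro x
    have h : A * (1 - z • T) = T - conj z • 1 := by
      rw [mul_assoc, Ring.inverse_mul_cancel _ hu, mul_one]
    exact congrArg (fun B : K →L[ℂ] K => B x) h
  have hnorm : ∀ y, ‖A y‖ = ‖y‖ := by
    intro y
    obtain ⟨x, rfl⟩ := exists_sub_smul_eq (norm_linearIsometryEquiv_le U) hz y
    have h := norm_sub_smul_sq_sub x (U x) z
    rw [U.norm_map, sub_self, mul_zero, sub_eq_zero] at h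
    have := (sq_eq_sq₀ (norm_nonneg _) (norm_nonneg _)).mp h
    exact (congrArg norm (hA x)).trans this.symm
  have hsurj : Function.Surjective A := by
    intro y
    -- Since U - z̄ = (1 - z̄U⁻¹)U, it is enough to solve with U⁻¹ and the parameter z̄.
    obtain ⟨x, hx⟩ := exists_sub_smul_eq (norm_linearIsometryEquiv_le U.symm)
      (z := conj z) (by rwa [norm_conj]) y
    refine ⟨U.symm x - z • U (U.symm x), ?_⟩
    rw [hA, U.apply_symm_apply]
    exact hx
  let A' : K →ₗᵢ[ℂ] K := ⟨A.toLinearMap, hnorm⟩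
  exact ⟨LinearIsometryEquiv.ofSurjective A' hsurj, hA⟩

theorem unitary_moebius_symm {U U' : K ≃ₗᵢ[ℂ] K} {z : ℂ} (hz : ‖z‖ < 1)
    (h : ∀ x, U' (x - z • U x) = U x - conj z • x) (y : K) :
    U (y - (-z) • U' y) = U' y - conj (-z) • y := by
  obtain ⟨x, rfl⟩ := exists_sub_smul_eq (norm_linearIsometryEquiv_le U) hz y
  have h' : U' (x - z • (U : K →L[ℂ] K) x) = U x - conj z • x := h x
  rw [h']
  have e1 : x - z • (U : K →L[ℂ] K) x - (-z) • (U x - conj z • x) = (1 - z * conj z) • x := by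
    change x - z • U x - (-z) • (U x - conj z • x) = _
    module
  rw [e1, map_smul, map_neg]
  change _ = U x - conj z • x - -conj z • (x - z • U x)
  module

theorem one_sub_norm_sq_ne_zero {z : ℂ} (hz : ‖z‖ < 1) : 1 - (‖z‖ : ℂ) ^ 2 ≠ 0 := by
  have h : (1 : ℝ) - ‖z‖ ^ 2 ≠ 0 := by nlinarith [norm_nonneg z]
  exact_mod_cast h

/-- The choice of t makes (1 - tU')(1 - zU) a scalar multiple of 1 - uU, so (1 - tU')⁻¹ is a
multiple of (1 - zU)(1 - uU)⁻¹. Writing 1 as a combination of 1 - uU and 1 - zU then gives the two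
terms. -/
theorem inverse_one_sub_moebius {U U' : K ≃ₗᵢ[ℂ] K} {z : ℂ} (hz : ‖z‖ < 1)
    (h : ∀ x, U' (x - z • U x) = U x - conj z • x) {u t : ℂ} (hu : ‖u‖ ≠ 1) (ht : ‖t‖ ≠ 1)
    (huz : u ≠ z) (hzu : 1 - conj z * u ≠ 0) (htu : t = (u - z) / (1 - conj z * u)) :
    Ring.inverse (1 - u • (U : K →L[ℂ] K)) = (-z / (u - z)) • (1 : K →L[ℂ] K)
      + (u * (1 - (‖z‖ : ℂ) ^ 2) / ((u - z) * (1 - conj z * u))) •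
        Ring.inverse (1 - t • (U' : K →L[ℂ] K)) := by
  set T : K →L[ℂ] K := (U : K →L[ℂ] K)
  set T' : K →L[ℂ] K := (U' : K →L[ℂ] K)
  have hTu : IsUnit (1 - u • T) := isUnit_one_sub_smul_unitary U hu
  have hTt : IsUnit (1 - t • T') := isUnit_one_sub_smul_unitary U' ht
  have hn : (‖z‖ : ℂ) ^ 2 = conj z * z := (conj_mul' z).symm
  have hn0 : 1 - conj z * z ≠ 0 := hn ▸ one_sub_norm_sq_ne_zero hz
  have huz' : u - z ≠ 0 := sub_ne_zero.mpr huz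
  have hT' : T' * (1 - z • T) = T - conj z • 1 := by
    ext x
    exact h x
  have h1 : (1 - t • T') * (1 - z • T) = ((1 - conj z * z) / (1 - conj z * u)) • (1 - u • T) := by
    have htu' : t * (1 - conj z * u) = u - z := by rw [htu, div_mul_cancel₀ _ hzu]
    have e1 : 1 + t * conj z = (1 - conj z * z) / (1 - conj z * u) := by
      rw [eq_div_iff hzu]
      linear_combination conj z * htu'
    have e2 : t + z = (1 - conj z * z) / (1 - conj z * u) * u := by
      rw [div_mul_eq_mul_div, eq_div_iff hzu]
      linear_combination htu'
    rw [sub_mul, one_mul, smul_mul_assoc, hT', smul_sub _ (1 : K →L[ℂ] K), smul_smul _ u, ← e2,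
      ← e1]
    module
  have h2 : Ring.inverse (1 - t • T') = ((1 - conj z * u) / (1 - conj z * z)) •
      ((1 - z • T) * Ring.inverse (1 - u • T)) := by
    have e : (1 - t • T') * (((1 - conj z * u) / (1 - conj z * z)) •
        ((1 - z • T) * Ring.inverse (1 - u • T))) = 1 := by
      rw [mul_smul_comm, ← mul_assoc, h1, smul_mul_assoc, Ring.mul_inverse_cancel _ hTu, smul_smul]
      have : (1 - conj z * u) / (1 - conj z * z) * ((1 - conj z * z) / (1 - conj z * u)) = 1 := by
        rw [div_mul_div_comm, mul_comm (1 - conj z * u), div_self (mul_ne_zero hn0 hzu)]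
      rw [this, one_smul]
    calc Ring.inverse (1 - t • T') = Ring.inverse (1 - t • T') * ((1 - t • T') *
          (((1 - conj z * u) / (1 - conj z * z)) •
            ((1 - z • T) * Ring.inverse (1 - u • T)))) := by rw [e, mul_one]
      _ = _ := by rw [← mul_assoc, Ring.inverse_mul_cancel _ hTt, one_mul]
  rw [h2, smul_smul, hn]
  have e3 : u * (1 - conj z * z) / ((u - z) * (1 - conj z * u))
      * ((1 - conj z * u) / (1 - conj z * z)) = u / (u - z) := by
    generalize 1 - conj z * u = d at hzu
    generalize 1 - conj z * z = e at hn0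
    field_simp
  rw [e3]
  have e4 : (-z / (u - z)) • (1 - u • T) + (u / (u - z)) • (1 - z • T) = 1 := by
    have : (1 : K →L[ℂ] K) = ((-z / (u - z)) + u / (u - z)) • (1 : K →L[ℂ] K) := by
      rw [show -z / (u - z) + u / (u - z) = 1 by field_simp; ring, one_smul]
    nth_rewrite 3 [this]
    rw [smul_sub, smul_sub, smul_smul, smul_smul, add_smul,
      show -z / (u - z) * u = -(u / (u - z) * z) by ring]
    module
  calc Ring.inverse (1 - u • T)
      = ((-z / (u - z)) • (1 - u • T) + (u / (u - z)) • (1 - z • T))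
          * Ring.inverse (1 - u • T) := by rw [e4, one_mul]
    _ = _ := by
      rw [add_mul, smul_mul_assoc, smul_mul_assoc, Ring.mul_inverse_cancel _ hTu]

end UnitaryMoebius

end LinearFractional

/-! ### Correspondence between the generalized resolvents of V and V_z -/

section MoebiusRelation

variable {H : Type u} [NormedAddCommGroup H] [InnerProductSpace ℂ H]

theorem UnitaryExtension.apply_of_mem_graph {V : H →ₗ.[ℂ] H} (W : UnitaryExtension V) {x w : H}
    (h : (x, w) ∈ V.graph) : W.U (W.J x) = W.J w := by
  obtain ⟨y, rfl, rfl⟩ := (LinearPMap.mem_graph_iff V).mp h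
  exact W.extends_V y

variable [CompleteSpace H]

/-- Generalized resolvents that coincide outside a finite set coincide. -/
theorem resolvent_ext_of_finite {V V' : H →ₗ.[ℂ] H} {W : UnitaryExtension V}
    {W' : UnitaryExtension V'} {s : Set ℂ} (hs : s.Finite)
    (h : ∀ ζ : OffCircle, (ζ : ℂ) ∉ s → W.resolvent ζ = W'.resolvent ζ) :
    W.resolvent = W'.resolvent := by
  funext ζ
  have h1 := (W.continuousAt_compress_inverse ζ.2).tendsto.mono_left
    (nhdsWithin_le_nhds (s := {(ζ : ℂ)}ᶜ))
  have h2 := (W'.continuousAt_compress_inverse ζ.2).tendsto.mono_left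
    (nhdsWithin_le_nhds (s := {(ζ : ℂ)}ᶜ))
  refine tendsto_nhds_unique_of_eventuallyEq h1 h2 ?_
  have hopen : IsOpen {z : ℂ | ‖z‖ ≠ 1} := isOpen_ne_fun continuous_norm continuous_const
  have h3 : ∀ᶠ z in 𝓝[≠] (ζ : ℂ), z ∉ s := by
    have := (hs.sdiff (t := {(ζ : ℂ)})).isClosed.isOpen_compl.mem_nhds
      (x := (ζ : ℂ)) (by simp)
    filter_upwards [nhdsWithin_le_nhds this, self_mem_nhdsWithin] with z hz hz' hzs
    exact hz ⟨hzs, hz'⟩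
  filter_upwards [nhdsWithin_le_nhds (hopen.mem_nhds ζ.2), h3] with z hz hzs
  exact h ⟨z, hz⟩ hzs

theorem moebiusRelation_of_unitary_moebius {V V' : H →ₗ.[ℂ] H} {z : UnitDisc}
    (W : UnitaryExtension V) (U' : W.K ≃ₗᵢ[ℂ] W.K)
    (hU' : ∀ x, U' (x - (z : ℂ) • W.U x) = W.U x - conj (z : ℂ) • x)
    (hext : ∀ x : V'.domain, U' (W.J x) = W.J (V' x)) :
    MoebiusRelation z W.resolvent
      (UnitaryExtension.resolvent (V := V') { K := W.K, J := W.J, U := U', extends_V := hext }) := by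
  intro u t _ huz hzu htu
  rw [UnitaryExtension.resolvent_eq,
    inverse_one_sub_moebius z.norm_lt_one hU' u.2 t.2 huz hzu htu, map_add, map_smul, map_smul,
    W.compress_one]
  rfl

theorem exists_moebiusRelation {V : H →ₗ.[ℂ] H} (hV : IsIsometric V) (z : UnitDisc)
    (W : UnitaryExtension V) :
    ∃ W' : UnitaryExtension (moebius z V), MoebiusRelation z W.resolvent W'.resolvent := by
  obtain ⟨U', hU'⟩ := exists_unitary_moebius W.U z.norm_lt_one
  refine ⟨_, moebiusRelation_of_unitary_moebius W U' hU' fun a => ?_⟩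
  obtain ⟨x, w, hw, ha, hb⟩ := (mem_graph_moebius hV z.norm_lt_one).mp ((moebius z V).mem_graph a)
  rw [ha, hb, map_sub W.J, map_sub W.J, map_smul, map_smul, ← W.apply_of_mem_graph hw, hU']

theorem exists_moebiusRelation_symm {V : H →ₗ.[ℂ] H} (hV : IsIsometric V) (z : UnitDisc)
    (W' : UnitaryExtension (moebius z V)) :
    ∃ W : UnitaryExtension V, MoebiusRelation z W.resolvent W'.resolvent := by
  have hz : ‖-(z : ℂ)‖ < 1 := by rw [norm_neg]; exact z.norm_lt_one
  obtain ⟨U, hU⟩ := exists_unitary_moebius W'.U hz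
  have hU' : ∀ x, W'.U (x - (z : ℂ) • U x) = U x - conj (z : ℂ) • x := fun x => by
    simpa using unitary_moebius_symm hz hU x
  have hext : ∀ x : V.domain, U (W'.J x) = W'.J (V x) := by
    intro x
    have hmem := (mem_graph_moebius hV z.norm_lt_one).mpr ⟨x, V x, V.mem_graph x, rfl, rfl⟩
    have h1 := W'.apply_of_mem_graph hmem
    have h2 := hU (W'.J (x - (z : ℂ) • V x))
    rw [h1, ← map_smul, ← map_smul, ← map_sub, ← map_sub] at h2
    have e1 : (x : H) - (z : ℂ) • V x - -(z : ℂ) • (V x - conj (z : ℂ) • (x : H))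
        = (1 - z * conj (z : ℂ)) • (x : H) := by module
    have e2 : V x - conj (z : ℂ) • (x : H) - conj (-(z : ℂ)) • ((x : H) - (z : ℂ) • V x)
        = (1 - z * conj (z : ℂ)) • V x := by
      rw [map_neg]
      module
    rw [e1, e2, map_smul, map_smul, map_smul] at h2
    refine smul_right_injective _ ?_ h2
    rw [mul_conj']
    exact one_sub_norm_sq_ne_zero z.norm_lt_one
  exact ⟨{ K := W'.K, J := W'.J, U := U, extends_V := hext },
    moebiusRelation_of_unitary_moebius (V := V) (V' := moebius z V)
      { K := W'.K, J := W'.J, U := U, extends_V := hext } W'.U hU' W'.extends_V⟩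

theorem norm_div_one_sub_ne_one {z u : ℂ} (hz : ‖z‖ < 1) (hu : ‖u‖ ≠ 1)
    (hzu : 1 - conj z * u ≠ 0) : ‖(u - z) / (1 - conj z * u)‖ ≠ 1 := by
  intro h
  rw [norm_div, div_eq_one_iff_eq (norm_ne_zero_iff.mpr hzu)] at h
  -- In the space ℂ this is |1 - z̄u|² - |u - z|² = (1 - |z|²)(1 - |u|²).
  have h1 := norm_sub_smul_sq_sub (1 : ℂ) u (conj z)
  simp only [smul_eq_mul, mul_one, conj_conj, h, sub_self, norm_conj, norm_one, one_pow] at h1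
  rcases mul_eq_zero.mp h1.symm with h2 | h2
  · nlinarith [norm_nonneg z]
  · refine hu ?_
    nlinarith [norm_nonneg u]

theorem one_sub_conj_mul_ne_zero {z u : ℂ} (h : u ≠ (conj z)⁻¹) : 1 - conj z * u ≠ 0 := by
  intro h0
  exact h (eq_inv_of_mul_eq_one_right (sub_eq_zero.mp h0).symm)

theorem resolvent_unique_left {V : H →ₗ.[ℂ] H} {z : UnitDisc} {W₁ W₂ : UnitaryExtension V}
    {Q : OffCircle → H →L[ℂ] H} (h₁ : MoebiusRelation z W₁.resolvent Q)
    (h₂ : MoebiusRelation z W₂.resolvent Q) : W₁.resolvent = W₂.resolvent := by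
  -- For z = 0 the last point takes the default value 0, which is excluded anyway.
  refine resolvent_ext_of_finite (s := {0, (z : ℂ), (conj (z : ℂ))⁻¹}) (Set.toFinite _) ?_
  intro u hu
  simp only [Set.mem_insert_iff, Set.mem_singleton_iff, not_or] at hu
  have hzu := one_sub_conj_mul_ne_zero hu.2.2
  have ht := norm_div_one_sub_ne_one z.norm_lt_one u.2 hzu
  rw [h₁ u ⟨_, ht⟩ hu.1 hu.2.1 hzu rfl, h₂ u ⟨_, ht⟩ hu.1 hu.2.1 hzu rfl]

theorem resolvent_unique_right {V : H →ₗ.[ℂ] H} {z : UnitDisc} {W₁ W₂ : UnitaryExtension V}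
    {R : OffCircle → H →L[ℂ] H} (h₁ : MoebiusRelation z R W₁.resolvent)
    (h₂ : MoebiusRelation z R W₂.resolvent) : W₁.resolvent = W₂.resolvent := by
  -- These values of t correspond to u = z, u = 0 and u = ∞ under the inverse map u = (t + z)/(1 +
  -- z̄t).
  refine resolvent_ext_of_finite (s := {0, -(z : ℂ), (conj (-(z : ℂ)))⁻¹}) (Set.toFinite _) ?_
  intro t ht
  simp only [Set.mem_insert_iff, Set.mem_singleton_iff, not_or] at ht
  have hd := one_sub_conj_mul_ne_zero ht.2.2
  have hz : ‖-(z : ℂ)‖ < 1 := by rw [norm_neg]; exact z.norm_lt_one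
  have hu := norm_div_one_sub_ne_one hz t.2 hd
  simp only [map_neg, sub_neg_eq_add, neg_mul] at hd hu
  have hn : 1 - conj (z : ℂ) * z ≠ 0 := by
    rw [conj_mul']
    exact one_sub_norm_sq_ne_zero z.norm_lt_one
  set u : ℂ := (t + z) / (1 + conj (z : ℂ) * t) with hudef
  have hud : u * (1 + conj (z : ℂ) * t) = t + z := div_mul_cancel₀ _ hd
  have e1 : (u - z) * (1 + conj (z : ℂ) * t) = (1 - conj (z : ℂ) * z) * t := by
    linear_combination hud
  have e2 : (1 - conj (z : ℂ) * u) * (1 + conj (z : ℂ) * t) = 1 - conj (z : ℂ) * z := by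
    linear_combination -conj (z : ℂ) * hud
  have hu0 : u ≠ 0 := by
    intro h
    rw [h, zero_mul] at hud
    exact ht.2.1 (eq_neg_of_add_eq_zero_left hud.symm)
  have huz : u ≠ z := by
    intro h
    rw [h, sub_self, zero_mul] at e1
    exact mul_ne_zero hn ht.1 e1.symm
  have hzu : 1 - conj (z : ℂ) * u ≠ 0 := by
    intro h
    rw [h, zero_mul] at e2
    exact hn e2.symm
  have htu : (t : ℂ) = (u - z) / (1 - conj (z : ℂ) * u) := by
    rw [eq_div_iff hzu]
    refine mul_right_cancel₀ hd ?_
    rw [e1, mul_assoc, e2, mul_comm]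
  have h := (h₁ ⟨u, hu⟩ t hu0 huz hzu htu).symm.trans (h₂ ⟨u, hu⟩ t hu0 huz hzu htu)
  refine smul_right_injective _ ?_ (add_left_cancel h)
  exact div_ne_zero (mul_ne_zero hu0 (one_sub_norm_sq_ne_zero z.norm_lt_one))
    (mul_ne_zero (sub_ne_zero.mpr huz) hzu)

theorem moebiusRelation_bijective {V : H →ₗ.[ℂ] H} (hV : IsIsometric V) (z : UnitDisc) :
    (∀ R ∈ GeneralizedResolvents V,
      ∃! Q, Q ∈ GeneralizedResolvents (moebius z V) ∧ MoebiusRelation z R Q) ∧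
    ∀ Q ∈ GeneralizedResolvents (moebius z V),
      ∃! R, R ∈ GeneralizedResolvents V ∧ MoebiusRelation z R Q := by
  constructor
  · rintro _ ⟨W, rfl⟩
    obtain ⟨W', h⟩ := exists_moebiusRelation hV z W
    refine ⟨_, ⟨⟨W', rfl⟩, h⟩, ?_⟩
    rintro _ ⟨⟨W'', rfl⟩, h''⟩
    exact resolvent_unique_right h'' h
  · rintro _ ⟨W', rfl⟩
    obtain ⟨W, h⟩ := exists_moebiusRelation_symm hV z W'
    refine ⟨_, ⟨⟨W, rfl⟩, h⟩, ?_⟩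
    rintro _ ⟨⟨W'', rfl⟩, h''⟩
    exact resolvent_unique_left h'' h

end MoebiusRelation

/-! ### Contractive extensions of V as orthogonal extensions -/

section OrthogonalExtension

section OperatorMoebius

variable {H : Type*} [NormedAddCommGroup H] [InnerProductSpace ℂ H] [CompleteSpace H]

/-- The linear-fractional transform `(T - z̄) (1 - z T)⁻¹` of a contraction. -/
def operatorMoebius (z : ℂ) (T : H →L[ℂ] H) : H →L[ℂ] H :=
  (T - conj z • 1) * Ring.inverse (1 - z • T)

variable {z : ℂ} {T : H →L[ℂ] H}

theorem operatorMoebius_apply (hz : ‖z‖ < 1) (hT : ‖T‖ ≤ 1) (x : H) :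
    operatorMoebius z T (x - z • T x) = T x - conj z • x := by
  have h : operatorMoebius z T * (1 - z • T) = T - conj z • 1 := by
    rw [operatorMoebius, mul_assoc, Ring.inverse_mul_cancel _ (isUnit_one_sub_smul hT hz), mul_one]
  exact congrArg (fun B : H →L[ℂ] H => B x) h

theorem norm_operatorMoebius_le (hz : ‖z‖ < 1) (hT : ‖T‖ ≤ 1) : ‖operatorMoebius z T‖ ≤ 1 := by
  refine ContinuousLinearMap.opNorm_le_bound _ zero_le_one fun y => ?_
  obtain ⟨x, rfl⟩ := exists_sub_smul_eq hT hz y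
  rw [operatorMoebius_apply hz hT, one_mul]
  refine le_of_sq_le_sq ?_ (norm_nonneg _)
  have h := norm_sub_smul_sq_sub x (T x) z
  have h1 : ‖T x‖ ≤ ‖x‖ := by simpa using T.le_of_opNorm_le hT x
  have h2 : 0 ≤ (1 - ‖z‖ ^ 2) * (‖x‖ ^ 2 - ‖T x‖ ^ 2) :=
    mul_nonneg (by nlinarith [norm_nonneg z]) (by nlinarith [norm_nonneg (T x)])
  linarith

theorem operatorMoebius_neg_operatorMoebius (hz : ‖z‖ < 1) (hT : ‖T‖ ≤ 1) :
    operatorMoebius (-z) (operatorMoebius z T) = T := by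
  have hz' : ‖-z‖ < 1 := by rwa [norm_neg]
  have hT' := norm_operatorMoebius_le hz hT
  ext x
  have hn : 1 - z * conj z ≠ 0 := by
    rw [mul_conj']
    exact one_sub_norm_sq_ne_zero hz
  have h := operatorMoebius_apply hz' hT' (x - z • T x)
  rw [operatorMoebius_apply hz hT] at h
  have e1 : x - z • T x - (-z) • (T x - conj z • x) = (1 - z * conj z) • x := by module
  have e2 : T x - conj z • x - conj (-z) • (x - z • T x) = (1 - z * conj z) • T x := by
    rw [map_neg]
    module
  rw [e1, e2, map_smul] at h
  exact smul_right_injective _ hn h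

theorem operatorMoebius_operatorMoebius_neg (hz : ‖z‖ < 1) (hT : ‖T‖ ≤ 1) :
    operatorMoebius z (operatorMoebius (-z) T) = T := by
  have := operatorMoebius_neg_operatorMoebius (z := -z) (by rwa [norm_neg]) hT
  rwa [neg_neg] at this

theorem analyticAt_operatorMoebius (hz : ‖z‖ < 1) {F : ℂ → H →L[ℂ] H} {w : ℂ}
    (hF : AnalyticAt ℂ F w) (hFw : ‖F w‖ ≤ 1) :
    AnalyticAt ℂ (fun v => operatorMoebius z (F v)) w :=
  (hF.sub analyticAt_const).mul (analyticAt_ringInverse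
    (analyticAt_const.sub (hF.const_smul (c := z))) (isUnit_one_sub_smul hFw hz))

theorem isInverse_iff {R S : H →L[ℂ] H} {ζ : ℂ} (hζ : ‖ζ‖ < 1) (hS : ‖S‖ ≤ 1) :
    IsInverse R (E H - ζ • S.toLinearMap.toPMap ⊤) ↔ R = Ring.inverse (1 - ζ • S) := by
  have hu : IsUnit (1 - ζ • S) := isUnit_one_sub_smul hS hζ
  constructor
  · rintro ⟨-, h⟩
    have h1 : R * (1 - ζ • S) = 1 := by
      ext x
      exact h ⟨x, trivial, trivial⟩
    calc R = R * ((1 - ζ • S) * Ring.inverse (1 - ζ • S)) := by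
          rw [Ring.mul_inverse_cancel _ hu, mul_one]
      _ = _ := by rw [← mul_assoc, h1, one_mul]
  · rintro rfl
    refine ⟨fun h => ⟨⟨trivial, trivial⟩, ?_⟩, fun f => ?_⟩
    · exact congrArg (fun A : H →L[ℂ] H => A h) (Ring.mul_inverse_cancel _ hu)
    · exact congrArg (fun A : H →L[ℂ] H => A f) (Ring.inverse_mul_cancel _ hu)

theorem eq_of_inverse_one_sub_smul_eq {S₁ S₂ : H →L[ℂ] H} {ζ : ℂ} (hζ : ‖ζ‖ < 1) (hζ0 : ζ ≠ 0)
    (h₁ : ‖S₁‖ ≤ 1) (h₂ : ‖S₂‖ ≤ 1)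
    (h : Ring.inverse (1 - ζ • S₁) = Ring.inverse (1 - ζ • S₂)) : S₁ = S₂ := by
  have hu₁ : IsUnit (1 - ζ • S₁) := isUnit_one_sub_smul h₁ hζ
  have hu₂ : IsUnit (1 - ζ • S₂) := isUnit_one_sub_smul h₂ hζ
  have h3 : 1 - ζ • S₁ = 1 - ζ • S₂ := by
    calc 1 - ζ • S₁ = (1 - ζ • S₁) * (Ring.inverse (1 - ζ • S₂) * (1 - ζ • S₂)) := by
          rw [Ring.inverse_mul_cancel _ hu₂, mul_one]
      _ = _ := by rw [← h, ← mul_assoc, Ring.mul_inverse_cancel _ hu₁, one_mul]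
  exact smul_right_injective _ hζ0 (sub_right_injective h3)

/-- A contraction that is isometric at `x` preserves inner products with `x`. -/
theorem inner_map_map_of_norm_eq (hT : ‖T‖ ≤ 1) {x : H} (hx : ‖T x‖ = ‖x‖) (y : H) :
    inner ℂ (T x) (T y) = inner ℂ x y := by
  -- Equality of norms gives ‖T*Tx - x‖² = ‖T*Tx‖² - ‖x‖², which is at most 0.
  have h1 : ContinuousLinearMap.adjoint T (T x) = x := by
    have h2 := norm_sub_sq (𝕜 := ℂ) (ContinuousLinearMap.adjoint T (T x)) x
    rw [ContinuousLinearMap.adjoint_inner_left, inner_self_eq_norm_sq (𝕜 := ℂ)] at h2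
    have h3 : ‖ContinuousLinearMap.adjoint T (T x)‖ ≤ ‖x‖ := by
      have := (ContinuousLinearMap.adjoint T).le_of_opNorm_le (c := 1)
        (by rwa [LinearIsometryEquiv.norm_map]) (T x)
      rwa [one_mul, hx] at this
    have h4 : ‖ContinuousLinearMap.adjoint T (T x) - x‖ ^ 2 ≤ 0 := by
      rw [h2, hx]
      nlinarith [norm_nonneg (ContinuousLinearMap.adjoint T (T x))]
    exact sub_eq_zero.mp (norm_eq_zero.mp (pow_eq_zero_iff two_ne_zero |>.mp
      (le_antisymm h4 (sq_nonneg _))))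
  rw [← ContinuousLinearMap.adjoint_inner_left, h1]

end OperatorMoebius

variable {H : Type*} [NormedAddCommGroup H] [InnerProductSpace ℂ H]

section Defect

variable {V : H →ₗ.[ℂ] H}

theorem mem_M_coe {ζ : ℂ} {a : H} :
    a ∈ M V (ζ : OnePoint ℂ) ↔ ∃ x w, (x, w) ∈ V.graph ∧ a = x - ζ • w := by
  change a ∈ Set.range (E H - ζ • V) ↔ _
  rw [LinearPMap.mem_range_iff]
  simp only [mem_graph_id_sub_smul]

theorem mem_M_infty {a : H} : a ∈ M V ∞ ↔ ∃ x, (x, a) ∈ V.graph := by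
  change a ∈ Set.range V ↔ _
  rw [LinearPMap.mem_range_iff]

/-- For z ≠ 0 the ranges of 1 - z̄⁻¹V and V - z̄ agree after scaling the argument by -z̄; the second
form also covers z = 0. -/
theorem mem_M_reflect {z : ℂ} {b : H} :
    b ∈ M V (reflect z) ↔ ∃ x w, (x, w) ∈ V.graph ∧ b = w - conj z • x := by
  by_cases hz : z = 0
  · simp [reflect, hz, mem_M_infty]
  · have hz' : conj z ≠ 0 := (map_ne_zero _).mpr hz
    rw [reflect, if_neg hz, mem_M_coe]
    constructor
    · rintro ⟨x, w, h, rfl⟩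
      refine ⟨_, _, V.graph.smul_mem (-(conj z)⁻¹) h, ?_⟩
      change _ = -(conj z)⁻¹ • w - conj z • (-(conj z)⁻¹ • x)
      rw [smul_smul, mul_neg, mul_inv_cancel₀ hz']
      module
    · rintro ⟨x, w, h, rfl⟩
      refine ⟨_, _, V.graph.smul_mem (-conj z) h, ?_⟩
      change _ = -conj z • x - (conj z)⁻¹ • (-conj z • w)
      rw [smul_smul, mul_neg, inv_mul_cancel₀ hz']
      module

variable (hV : IsIsometric V) {z : ℂ} (hz : ‖z‖ < 1)
include hV hz

theorem moebius_domain : (moebius z V).domain = M V (z : OnePoint ℂ) := by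
  ext a
  rw [LinearPMap.mem_domain_iff, mem_M_coe]
  simp only [mem_graph_moebius hV hz]
  aesop

theorem mem_M_reflect_of_mem_graph_moebius {a b : H} (h : (a, b) ∈ (moebius z V).graph) :
    b ∈ M V (reflect z) := by
  obtain ⟨x, w, hw, -, hb⟩ := (mem_graph_moebius hV hz).mp h
  exact mem_M_reflect.mpr ⟨x, w, hw, hb⟩

theorem norm_eq_of_mem_graph_moebius {a b : H} (h : (a, b) ∈ (moebius z V).graph) :
    ‖b‖ = ‖a‖ := by
  obtain ⟨x, w, hw, rfl, rfl⟩ := (mem_graph_moebius hV hz).mp h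
  have h1 := norm_sub_smul_sq_sub x w z
  rw [norm_eq_of_mem_graph hV hw, sub_self, mul_zero, sub_eq_zero] at h1
  exact ((sq_eq_sq₀ (norm_nonneg _) (norm_nonneg _)).mp h1).symm

theorem exists_mem_graph_moebius_of_mem_M_reflect {b : H} (h : b ∈ M V (reflect z)) :
    ∃ a, (a, b) ∈ (moebius z V).graph := by
  obtain ⟨x, w, hw, hb⟩ := mem_M_reflect.mp h
  exact ⟨_, (mem_graph_moebius hV hz).mpr ⟨x, w, hw, rfl, hb⟩⟩

/-- The map (x, w) ↦ x - zw is bounded below by 1 - ‖z‖ on the graph of V, which is complete because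
V is closed. -/
theorem isClosed_M [CompleteSpace H] (hc : V.IsClosed) :
    IsClosed (M V (z : OnePoint ℂ) : Set H) := by
  have : CompleteSpace V.graph := completeSpace_coe_iff_isComplete.mpr (IsClosed.isComplete hc)
  let f : V.graph →L[ℂ] H :=
    (ContinuousLinearMap.fst ℂ H H - z • ContinuousLinearMap.snd ℂ H H) ∘L V.graph.subtypeL
  have hf : ∀ p : V.graph, f p = p.1.1 - z • p.1.2 := fun _ => rfl
  have hz1 : 0 < 1 - ‖z‖ := sub_pos.mpr hz
  have hanti : AntilipschitzWith (Real.toNNReal (1 - ‖z‖)⁻¹) f := by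
    refine AddMonoidHomClass.antilipschitz_of_bound f fun p => ?_
    have hp : ‖p.1.2‖ = ‖p.1.1‖ := norm_eq_of_mem_graph hV p.2
    have h1 := norm_sub_smul_ge hp.le z
    have h2 : ‖p‖ = ‖p.1.1‖ := by
      change max ‖p.1.1‖ ‖p.1.2‖ = _
      rw [hp, max_self]
    rw [Real.coe_toNNReal _ (inv_nonneg.mpr hz1.le), h2, hf, le_inv_mul_iff₀ hz1]
    exact h1
  have h := hanti.isClosed_range f.uniformContinuous
  convert h using 1
  ext a
  rw [SetLike.mem_coe, mem_M_coe]
  constructor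
  · rintro ⟨x, w, hw, rfl⟩
    exact ⟨⟨(x, w), hw⟩, rfl⟩
  · rintro ⟨p, rfl⟩
    exact ⟨p.1.1, p.1.2, p.2, rfl⟩

end Defect

variable [CompleteSpace H] {V : H →ₗ.[ℂ] H}

instance (ζ : OnePoint ℂ) : CompleteSpace (N V ζ) := by
  unfold N
  infer_instance

/-- This is V_z ⊕ 0: V_z preceded by the projection onto its closed domain. It turns V⁺ into an
affine function of C with values in the bounded operators. -/
theorem exists_moebius_zero_extension (hV : IsIsometric V) (hc : V.IsClosed) {z : ℂ}
    (hz : ‖z‖ < 1) :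
    ∃ T₀ : H →L[ℂ] H, (∀ a b, (a, b) ∈ (moebius z V).graph → T₀ a = b) ∧
      ∀ n ∈ N V z, T₀ n = 0 := by
  have hdom := moebius_domain hV hz
  have : CompleteSpace (moebius z V).domain := by
    rw [hdom]
    exact (isClosed_M hV hz hc).completeSpace_coe
  let A : (moebius z V).domain →L[ℂ] H := (moebius z V).toFun.mkContinuous 1 fun a => by
    rw [one_mul]
    exact (norm_eq_of_mem_graph_moebius hV hz ((moebius z V).mem_graph a)).le
  refine ⟨A ∘L (moebius z V).domain.orthogonalProjectionOnto, fun a b h => ?_, fun n hn => ?_⟩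
  · obtain ⟨x, rfl, rfl⟩ := (LinearPMap.mem_graph_iff _).mp h
    rw [ContinuousLinearMap.comp_apply, Submodule.orthogonalProjectionOnto_mem_subspace_eq_self]
    rfl
  · rw [ContinuousLinearMap.comp_apply,
      Submodule.orthogonalProjectionOnto_apply_of_mem_orthogonal (by rw [hdom]; exact hn),
      map_zero]

/-- The bounded operator `T₀ ⊕ C`, where `T₀` vanishes on the defect subspace. -/
def blockOperator {z : ℂ} (T₀ : H →L[ℂ] H) (C : N V z →L[ℂ] N V (reflect z)) : H →L[ℂ] H :=
  T₀ + (N V (reflect z)).subtypeL ∘L C ∘L (N V z).orthogonalProjectionOnto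

section Block

variable {z : ℂ} {T₀ : H →L[ℂ] H}

theorem blockOperator_apply_of_mem_M (C : N V z →L[ℂ] N V (reflect z)) {a : H} (h : a ∈ M V z) :
    blockOperator T₀ C a = T₀ a := by
  have : (N V z).orthogonalProjectionOnto a = 0 :=
    Submodule.orthogonalProjectionOnto_apply_of_mem_orthogonal
      (Submodule.le_orthogonal_orthogonal _ h)
  simp [blockOperator, this]

theorem blockOperator_apply_of_mem_N (h₀ : ∀ n ∈ N V z, T₀ n = 0)
    (C : N V z →L[ℂ] N V (reflect z)) (n : N V z) : blockOperator T₀ C n = C n := by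
  simp [blockOperator, h₀ n n.2]

theorem blockOperator_injective (h₀ : ∀ n ∈ N V z, T₀ n = 0) :
    Function.Injective (blockOperator (V := V) (z := z) T₀) := by
  intro C C' h
  ext n
  rw [← blockOperator_apply_of_mem_N h₀, h, blockOperator_apply_of_mem_N h₀]

variable (hV : IsIsometric V) (hc : V.IsClosed) (hz : ‖z‖ < 1)
include hV hc hz

theorem exists_mem_M_mem_N (x : H) : ∃ m ∈ M V z, ∃ n ∈ N V z, x = m + n := by
  have : CompleteSpace (M V (z : OnePoint ℂ)) := (isClosed_M hV hz hc).completeSpace_coe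
  exact Submodule.exists_add_mem_mem_orthogonal x

variable (hT₀ : ∀ a b, (a, b) ∈ (moebius z V).graph → T₀ a = b) (h₀ : ∀ n ∈ N V z, T₀ n = 0)
include hT₀

omit [CompleteSpace H] hc in
theorem mem_graph_moebius_of_mem_M {a : H} (ha : a ∈ M V z) :
    (a, T₀ a) ∈ (moebius z V).graph := by
  rw [← moebius_domain hV hz] at ha
  have h := (moebius z V).mem_graph ⟨a, ha⟩
  rwa [← hT₀ _ _ h] at h

include h₀

theorem mem_graph_plusExtension (C : N V z →L[ℂ] N V (reflect z)) {a b : H} :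
    (a, b) ∈ (plusExtension V z C).graph ↔ b = blockOperator T₀ C a := by
  rw [plusExtension, mem_graph_sup]
  have hM : ∀ {x w}, (x, w) ∈ (moebius z V).graph → x ∈ M V z := fun h => by
    rw [← moebius_domain hV hz]
    exact LinearPMap.mem_domain_of_mem_graph h
  constructor
  · rintro ⟨x, w, y, v, hx, hy, rfl, rfl⟩
    obtain ⟨n, rfl, rfl⟩ := (LinearPMap.mem_graph_iff _).mp hy
    rw [map_add, blockOperator_apply_of_mem_M C (hM hx), hT₀ _ _ hx]
    exact congrArg _ (blockOperator_apply_of_mem_N h₀ C n).symm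
  · rintro rfl
    obtain ⟨m, hm, n, hn, rfl⟩ := exists_mem_M_mem_N hV hc hz a
    refine ⟨m, T₀ m, n, C ⟨n, hn⟩, mem_graph_moebius_of_mem_M hV hz hT₀ hm,
      (LinearPMap.mem_graph_iff _).mpr ⟨⟨n, hn⟩, rfl, rfl⟩, rfl, ?_⟩
    rw [map_add, blockOperator_apply_of_mem_M C hm]
    exact congrArg _ (blockOperator_apply_of_mem_N h₀ C ⟨n, hn⟩)

/-- The two blocks have orthogonal domains and orthogonal ranges, so Pythagoras applies on both
sides. -/
theorem norm_blockOperator_le {C : N V z →L[ℂ] N V (reflect z)} (hC : ‖C‖ ≤ 1) :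
    ‖blockOperator T₀ C‖ ≤ 1 := by
  refine ContinuousLinearMap.opNorm_le_bound _ zero_le_one fun x => ?_
  obtain ⟨m, hm, n, hn, rfl⟩ := exists_mem_M_mem_N hV hc hz x
  have hg := mem_graph_moebius_of_mem_M hV hz hT₀ hm
  have h1 : blockOperator T₀ C (m + n) = T₀ m + C ⟨n, hn⟩ := by
    rw [map_add, blockOperator_apply_of_mem_M C hm]
    exact congrArg _ (blockOperator_apply_of_mem_N h₀ C ⟨n, hn⟩)
  have h2 : inner ℂ (T₀ m) (C ⟨n, hn⟩ : H) = 0 :=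
    Submodule.inner_right_of_mem_orthogonal (mem_M_reflect_of_mem_graph_moebius hV hz hg)
      (C ⟨n, hn⟩).2
  have h3 : inner ℂ m n = 0 := Submodule.inner_right_of_mem_orthogonal hm hn
  have h4 : ‖(C ⟨n, hn⟩ : H)‖ ≤ ‖n‖ := by simpa using C.le_of_opNorm_le hC ⟨n, hn⟩
  rw [one_mul, h1]
  refine le_of_sq_le_sq ?_ (norm_nonneg _)
  rw [sq, sq, norm_add_sq_eq_norm_sq_add_norm_sq_of_inner_eq_zero _ _ h2,
    norm_add_sq_eq_norm_sq_add_norm_sq_of_inner_eq_zero _ _ h3,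
    norm_eq_of_mem_graph_moebius hV hz hg]
  gcongr

/-- The formula for V_C is the transform with parameter -z applied to the everywhere defined
contraction V⁺. -/
theorem orthogonalExtension_eq {C : N V z →L[ℂ] N V (reflect z)} (hC : ‖C‖ ≤ 1) :
    orthogonalExtension V z C =
      (operatorMoebius (-z) (blockOperator T₀ C)).toLinearMap.toPMap ⊤ := by
  have hT := norm_blockOperator_le hV hc hz hT₀ h₀ hC
  have hP : ∀ {a b}, (a, b) ∈ (plusExtension V z C).graph ↔ b = blockOperator T₀ C a :=
    mem_graph_plusExtension hV hc hz hT₀ h₀ C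
  have hz' : ‖-z‖ < 1 := by rwa [norm_neg]
  set T := blockOperator T₀ C
  have hM := operatorMoebius_apply hz' hT
  simp only [neg_smul, sub_neg_eq_add, map_neg] at hM
  have hinj : ∀ x, (x, (0 : H)) ∈ (E H + z • plusExtension V z C).graph → x = 0 := by
    intro x hx
    obtain ⟨w, hw, h⟩ := mem_graph_id_add_smul.mp hx
    rw [hP.mp hw] at h
    have h1 : ‖T x‖ ≤ ‖x‖ := by simpa using T.le_of_opNorm_le hT x
    refine eq_zero_of_sub_smul_eq_zero h1 hz' ?_
    rw [h]
    module
  refine LinearPMap.eq_of_eq_graph ?_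
  ext ⟨a, b⟩
  rw [mem_graph_toPMap_top, orthogonalExtension, mem_graph_product]
  simp only [mem_graph_inverse hinj, mem_graph_id_add_smul]
  simp only [mem_graph_add, mem_graph_smul, mem_graph_E, hP]
  constructor
  · rintro ⟨x, ⟨_, rfl, rfl⟩, _, _, rfl, ⟨_, rfl, rfl⟩, rfl⟩
    exact (hM _).symm
  · rintro rfl
    obtain ⟨x, hx⟩ := exists_sub_smul_eq hT hz' a
    rw [neg_smul, sub_neg_eq_add] at hx
    refine ⟨x, ⟨_, rfl, hx.symm⟩, _, _, rfl, ⟨_, rfl, rfl⟩, ?_⟩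
    rw [← hx]
    exact hM x

theorem operatorMoebius_block_apply {C : N V z →L[ℂ] N V (reflect z)} (hC : ‖C‖ ≤ 1) (x : V.domain) :
    operatorMoebius (-z) (blockOperator T₀ C) x = V x := by
  have hT := norm_blockOperator_le hV hc hz hT₀ h₀ hC
  have hz' : ‖-z‖ < 1 := by rwa [norm_neg]
  have hmem := (mem_graph_moebius hV hz).mpr ⟨x, V x, V.mem_graph x, rfl, rfl⟩
  have hB : blockOperator T₀ C ((x : H) - z • V x) = V x - conj z • (x : H) := by
    rw [blockOperator_apply_of_mem_M C (mem_M_coe.mpr ⟨x, V x, V.mem_graph x, rfl⟩), hT₀ _ _ hmem]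
  have h := operatorMoebius_apply hz' hT ((x : H) - z • V x)
  rw [hB] at h
  have e1 : (x : H) - z • V x - (-z) • (V x - conj z • (x : H)) = (1 - z * conj z) • (x : H) := by
    module
  have e2 : V x - conj z • (x : H) - conj (-z) • ((x : H) - z • V x)
      = (1 - z * conj z) • V x := by
    rw [map_neg]
    module
  rw [e1, e2, map_smul] at h
  refine smul_right_injective _ ?_ h
  rw [mul_conj']
  exact one_sub_norm_sq_ne_zero hz

/-- Every contractive extension of `V` is an orthogonal extension. -/
theorem exists_blockOperator_eq {S : H →L[ℂ] H} (hS : ‖S‖ ≤ 1) (hSV : ∀ x : V.domain, S x = V x) :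
    blockOperator T₀ ((N V (reflect z)).orthogonalProjectionOnto ∘L operatorMoebius z S ∘L
      (N V z).subtypeL) = operatorMoebius z S := by
  have hT := norm_operatorMoebius_le hz hS
  have hgraph : ∀ {a b}, (a, b) ∈ (moebius z V).graph → operatorMoebius z S a = b := by
    intro a b h
    obtain ⟨x, w, hw, rfl, rfl⟩ := (mem_graph_moebius hV hz).mp h
    obtain ⟨y, rfl, rfl⟩ := (LinearPMap.mem_graph_iff _).mp hw
    rw [← hSV, operatorMoebius_apply hz hS]
  ext x
  obtain ⟨m, hm, n, hn, rfl⟩ := exists_mem_M_mem_N hV hc hz x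
  have hg := mem_graph_moebius_of_mem_M hV hz hT₀ hm
  -- Each b in M_{1/z̄} is the image of some a in M_z on which the contraction is isometric, so ⟨b,
  -- Tn⟩ = ⟨Ta, Tn⟩ = ⟨a, n⟩ = 0.
  have hTn : operatorMoebius z S n ∈ N V (reflect z) := by
    rw [N, Submodule.mem_orthogonal]
    intro b hb
    obtain ⟨a, ha⟩ := exists_mem_graph_moebius_of_mem_M_reflect hV hz hb
    rw [← hgraph ha, inner_map_map_of_norm_eq hT]
    · have ha' : a ∈ M V z := by
        rw [← moebius_domain hV hz]
        exact LinearPMap.mem_domain_of_mem_graph ha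
      exact Submodule.inner_right_of_mem_orthogonal ha' hn
    · rw [hgraph ha, norm_eq_of_mem_graph_moebius hV hz ha]
  rw [map_add, map_add, blockOperator_apply_of_mem_M _ hm, hgraph hg]
  congr 1
  have h := blockOperator_apply_of_mem_N h₀ ((N V (reflect z)).orthogonalProjectionOnto ∘L
    operatorMoebius z S ∘L (N V z).subtypeL) ⟨n, hn⟩
  refine h.trans ?_
  exact congrArg Subtype.val
    (Submodule.orthogonalProjectionOnto_mem_subspace_eq_self ⟨operatorMoebius z S n, hTn⟩)

end Block

end OrthogonalExtension

/-! ### Inin's formula -/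

section Inin

theorem analyticAt_comp_comp {E₁ E₂ E₃ E₄ : Type*} [NormedAddCommGroup E₁] [NormedSpace ℂ E₁]
    [NormedAddCommGroup E₂] [NormedSpace ℂ E₂] [NormedAddCommGroup E₃] [NormedSpace ℂ E₃]
    [NormedAddCommGroup E₄] [NormedSpace ℂ E₄] {f : ℂ → E₂ →L[ℂ] E₃} {w : ℂ}
    (hf : AnalyticAt ℂ f w) (A : E₃ →L[ℂ] E₄) (B : E₁ →L[ℂ] E₂) :
    AnalyticAt ℂ (fun v => A ∘L f v ∘L B) w :=
  (((ContinuousLinearMap.compL ℂ E₁ E₃ E₄ A) ∘L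
    (ContinuousLinearMap.compL ℂ E₁ E₂ E₃).flip B).analyticAt _).comp hf

variable {H : Type u} [NormedAddCommGroup H] [InnerProductSpace ℂ H]

theorem norm_compression_le (K L : Submodule ℂ H) [L.HasOrthogonalProjection] {T : H →L[ℂ] H}
    (hT : ‖T‖ ≤ 1) : ‖L.orthogonalProjectionOnto ∘L T ∘L K.subtypeL‖ ≤ 1 :=
  (ContinuousLinearMap.opNorm_comp_le _ _).trans (mul_le_one₀ L.orthogonalProjectionOnto_norm_le
    (norm_nonneg _) ((ContinuousLinearMap.opNorm_comp_le _ _).trans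
      (mul_le_one₀ hT (norm_nonneg _) K.norm_subtypeL_le)))

/-- Functions of the Schur class that coincide away from the origin coincide. -/
theorem schurClass_ext {H₁ H₂ : Submodule ℂ H} {C C' : UnitDisc → H₁ →L[ℂ] H₂}
    (hC : C ∈ SchurClass H₁ H₂) (hC' : C' ∈ SchurClass H₁ H₂)
    (h : ∀ ζ : UnitDisc, (ζ : ℂ) ≠ 0 → C ζ = C' ζ) : C = C' := by
  obtain ⟨⟨G, hG, hGC⟩, -⟩ := hC
  obtain ⟨⟨G', hG', hGC'⟩, -⟩ := hC'
  funext ζ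
  by_cases hζ : (ζ : ℂ) = 0
  · have hmem : (0 : ℂ) ∈ Metric.ball (0 : ℂ) 1 := by simp
    have h1 := (hG 0 hmem).continuousAt.tendsto.mono_left (nhdsWithin_le_nhds (s := {(0 : ℂ)}ᶜ))
    have h2 := (hG' 0 hmem).continuousAt.tendsto.mono_left (nhdsWithin_le_nhds (s := {(0 : ℂ)}ᶜ))
    rw [← hGC, ← hGC', hζ]
    refine tendsto_nhds_unique_of_eventuallyEq h1 h2 ?_
    filter_upwards [nhdsWithin_le_nhds (Metric.isOpen_ball.mem_nhds hmem), self_mem_nhdsWithin]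
      with w hw hw0
    have hw1 : ‖w‖ < 1 := by simpa using hw
    have := h (UnitDisc.mk w hw1) hw0
    rw [← hGC, ← hGC'] at this
    exact this
  · exact h ζ hζ

variable [CompleteSpace H] {V : H →ₗ.[ℂ] H}

theorem ininFormula_iff (hV : IsIsometric V) (hc : V.IsClosed) {z : UnitDisc} {T₀ : H →L[ℂ] H}
    (hT₀ : ∀ a b, (a, b) ∈ (moebius z V).graph → T₀ a = b) (h₀ : ∀ n ∈ N V (z : ℂ), T₀ n = 0)
    {C : UnitDisc → N V (z : ℂ) →L[ℂ] N V (reflect z)} (hC : ∀ ζ, ‖C ζ‖ ≤ 1)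
    {R : OffCircle → H →L[ℂ] H} :
    IninFormula V z R C ↔ ∀ ζ : UnitDisc, R (discPoint ζ) =
      Ring.inverse (1 - (ζ : ℂ) • operatorMoebius (-(z : ℂ)) (blockOperator T₀ (C ζ))) := by
  have hz' : ‖-(z : ℂ)‖ < 1 := by rw [norm_neg]; exact z.norm_lt_one
  refine forall_congr' fun ζ => ?_
  rw [orthogonalExtension_eq hV hc z.norm_lt_one hT₀ h₀ (hC ζ)]
  exact isInverse_iff ζ.norm_lt_one (norm_operatorMoebius_le hz'
    (norm_blockOperator_le hV hc z.norm_lt_one hT₀ h₀ (hC ζ)))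

theorem ininFormula_unique (hV : IsIsometric V) (hc : V.IsClosed) {z : UnitDisc}
    {C C' : UnitDisc → N V (z : ℂ) →L[ℂ] N V (reflect z)} {R : OffCircle → H →L[ℂ] H}
    (hC : C ∈ SchurClass (N V (z : ℂ)) (N V (reflect z)))
    (hC' : C' ∈ SchurClass (N V (z : ℂ)) (N V (reflect z)))
    (h : IninFormula V z R C) (h' : IninFormula V z R C') : C = C' := by
  obtain ⟨T₀, hT₀, h₀⟩ := exists_moebius_zero_extension hV hc z.norm_lt_one
  rw [ininFormula_iff hV hc hT₀ h₀ hC.2] at h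
  rw [ininFormula_iff hV hc hT₀ h₀ hC'.2] at h'
  have hz' : ‖-(z : ℂ)‖ < 1 := by rw [norm_neg]; exact z.norm_lt_one
  -- At ζ = 0 the resolvent is E whatever C is, so that point is recovered by continuity only.
  refine schurClass_ext hC hC' fun ζ hζ => ?_
  have hT := norm_blockOperator_le hV hc z.norm_lt_one hT₀ h₀ (hC.2 ζ)
  have hT' := norm_blockOperator_le hV hc z.norm_lt_one hT₀ h₀ (hC'.2 ζ)
  have h1 := eq_of_inverse_one_sub_smul_eq ζ.norm_lt_one hζ (norm_operatorMoebius_le hz' hT)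
    (norm_operatorMoebius_le hz' hT') ((h ζ).symm.trans (h' ζ))
  have h2 := congrArg (operatorMoebius (z : ℂ)) h1
  rw [operatorMoebius_operatorMoebius_neg z.norm_lt_one hT,
    operatorMoebius_operatorMoebius_neg z.norm_lt_one hT'] at h2
  exact blockOperator_injective h₀ h2

theorem exists_schurClass_ininFormula (hV : IsIsometric V) (hc : V.IsClosed) (z : UnitDisc)
    (W : UnitaryExtension V) :
    ∃ C ∈ SchurClass (N V (z : ℂ)) (N V (reflect z)), IninFormula V z W.resolvent C := by
  obtain ⟨T₀, hT₀, h₀⟩ := exists_moebius_zero_extension hV hc z.norm_lt_one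
  obtain ⟨S, hS, hS1, hSV, hR⟩ := W.exists_contractive_extension
  have hmem : ∀ ζ : UnitDisc, (ζ : ℂ) ∈ Metric.ball (0 : ℂ) 1 := fun ζ => by
    simpa using ζ.norm_lt_one
  -- The parameter is the corner of the transformed characteristic function between the two defect
  -- subspaces.
  let G : ℂ → N V (z : ℂ) →L[ℂ] N V (reflect z) := fun w =>
    (N V (reflect z)).orthogonalProjectionOnto ∘L operatorMoebius z (S w) ∘L
      (N V (z : ℂ)).subtypeL
  have hG1 : ∀ ζ : UnitDisc, ‖G ζ‖ ≤ 1 := fun ζ =>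
    norm_compression_le _ _ (norm_operatorMoebius_le z.norm_lt_one (hS1 ζ (hmem ζ)))
  refine ⟨fun ζ => G ζ, ⟨⟨G, fun w hw => ?_, fun _ => rfl⟩, hG1⟩, ?_⟩
  · exact analyticAt_comp_comp
      (analyticAt_operatorMoebius z.norm_lt_one (hS w hw) (hS1 w hw)) _ _
  · rw [ininFormula_iff hV hc hT₀ h₀ hG1]
    intro ζ
    rw [hR, exists_blockOperator_eq hV hc z.norm_lt_one hT₀ h₀ (hS1 ζ (hmem ζ)) (hSV ζ (hmem ζ)),
      operatorMoebius_neg_operatorMoebius z.norm_lt_one (hS1 ζ (hmem ζ))]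

theorem exists_unitaryExtension_ininFormula [TopologicalSpace.SeparableSpace H]
    (hV : IsIsometric V) (hc : V.IsClosed) {z : UnitDisc}
    {C : UnitDisc → N V (z : ℂ) →L[ℂ] N V (reflect z)}
    (hC : C ∈ SchurClass (N V (z : ℂ)) (N V (reflect z))) :
    ∃ W : UnitaryExtension V, IninFormula V z W.resolvent C := by
  obtain ⟨T₀, hT₀, h₀⟩ := exists_moebius_zero_extension hV hc z.norm_lt_one
  obtain ⟨⟨G, hG, hGC⟩, hC1⟩ := id hC
  have hz' : ‖-(z : ℂ)‖ < 1 := by rw [norm_neg]; exact z.norm_lt_one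
  have hG1 : ∀ w ∈ Metric.ball (0 : ℂ) 1, ‖G w‖ ≤ 1 := fun w hw => by
    have := hC1 (UnitDisc.mk w (by simpa using hw))
    rwa [← hGC] at this
  have hB1 : ∀ w ∈ Metric.ball (0 : ℂ) 1, ‖blockOperator T₀ (G w)‖ ≤ 1 := fun w hw =>
    norm_blockOperator_le hV hc z.norm_lt_one hT₀ h₀ (hG1 w hw)
  obtain ⟨W, hW⟩ := exists_unitaryExtension (V := V) hV
    (S := fun w => operatorMoebius (-(z : ℂ)) (blockOperator T₀ (G w)))
    (fun w hw => analyticAt_operatorMoebius hz'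
      (analyticAt_const.add (analyticAt_comp_comp (hG w hw) _ _)) (hB1 w hw))
    (fun w hw => norm_operatorMoebius_le hz' (hB1 w hw))
    (operatorMoebius_block_apply hV hc z.norm_lt_one hT₀ h₀ (hG1 0 (by simp)))
  refine ⟨W, (ininFormula_iff hV hc hT₀ h₀ hC1).mpr fun ζ => ?_⟩
  rw [hW, hGC]

theorem ininFormula_bijective [TopologicalSpace.SeparableSpace H] (hV : IsIsometric V)
    (hc : V.IsClosed) (z : UnitDisc) :
    (∀ R ∈ GeneralizedResolvents V,
      ∃! C, C ∈ SchurClass (N V (z : ℂ)) (N V (reflect z)) ∧ IninFormula V z R C) ∧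
    ∀ C ∈ SchurClass (N V (z : ℂ)) (N V (reflect z)),
      ∃! R, R ∈ GeneralizedResolvents V ∧ IninFormula V z R C := by
  constructor
  · rintro _ ⟨W, rfl⟩
    obtain ⟨C, hC, h⟩ := exists_schurClass_ininFormula hV hc z W
    exact ⟨C, ⟨hC, h⟩, fun C' h' => ininFormula_unique hV hc h'.1 hC h'.2 h⟩
  · intro C hC
    obtain ⟨W, h⟩ := exists_unitaryExtension_ininFormula hV hc hC
    refine ⟨W.resolvent, ⟨⟨W, rfl⟩, h⟩, ?_⟩
    rintro _ ⟨⟨W', rfl⟩, h'⟩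
    obtain ⟨T₀, hT₀, h₀⟩ := exists_moebius_zero_extension hV hc z.norm_lt_one
    rw [ininFormula_iff hV hc hT₀ h₀ hC.2] at h h'
    -- Inin's formula fixes the resolvent on the disc, and reflection fixes it outside.
    exact UnitaryExtension.resolvent_ext fun ζ => (h' ζ).trans (h ζ).symm

end Inin

end

end IsometricResolvent

theorem mainTheorem4 {H : Type u} [NormedAddCommGroup H] [InnerProductSpace ℂ H]
    [CompleteSpace H] [TopologicalSpace.SeparableSpace H]
    (V : H →ₗ.[ℂ] H) (hclosed : V.IsClosed) (hisometric : IsometricResolvent.IsIsometric V)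
    (z₀ : Complex.UnitDisc) :
    -- Inin's formula is a bijection between generalized resolvents and contractive functions
    ((∀ R ∈ IsometricResolvent.GeneralizedResolvents V,
        ∃! C, C ∈ IsometricResolvent.SchurClass (IsometricResolvent.N V (z₀ : ℂ))
            (IsometricResolvent.N V (IsometricResolvent.reflect z₀)) ∧
          IsometricResolvent.IninFormula V z₀ R C) ∧
      (∀ C ∈ IsometricResolvent.SchurClass (IsometricResolvent.N V (z₀ : ℂ))
          (IsometricResolvent.N V (IsometricResolvent.reflect z₀)),
        ∃! R, R ∈ IsometricResolvent.GeneralizedResolvents V ∧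
          IsometricResolvent.IninFormula V z₀ R C)) ∧
    -- the generalized resolvents of `V` and of `V_{z₀}` correspond bijectively
    ((∀ R ∈ IsometricResolvent.GeneralizedResolvents V,
        ∃! Q, Q ∈ IsometricResolvent.GeneralizedResolvents (IsometricResolvent.moebius z₀ V) ∧
          IsometricResolvent.MoebiusRelation z₀ R Q) ∧
      (∀ Q ∈ IsometricResolvent.GeneralizedResolvents (IsometricResolvent.moebius z₀ V),
        ∃! R, R ∈ IsometricResolvent.GeneralizedResolvents V ∧
          IsometricResolvent.MoebiusRelation z₀ R Q)) := by
  exact ⟨IsometricResolvent.ininFormula_bijective hisometric hclosed z₀,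
    IsometricResolvent.moebiusRelation_bijective hisometric z₀⟩
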